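/- Let $n\ge 2$ bidders compete for $m\ge 1$ identical indivisible units. Bidder $i$ has a private valuation $\eta_i>0$ per unit and a private budget $\beta_i>0$, and reports $v_i>0$ and $B_i>0$. A randomized auction maps the reports $(\vec v,\vec B)$ to a random outcome, in which bidder $i$ gets $X_i\in\{0,\dots,m\}$ units and pays a total price $P_i$; the utility of $i$ is $u_i=\eta_iX_i-P_i$ if $P_i\le\beta_i$, and $-\infty$ if $P_i>\beta_i$. There is a randomized auction with the following properties. (NPT, always) For all reports, $P_i\ge 0$ for all $i$ in every realization. (VP, in expectation) If $v_i=\eta_i$ and $B_i=\beta_i$, then $\mathbb E[u_i]\ge 0$, whatever the others report. (IC, in expectation) Whatever the others report, $\mathbb E[u_i]$ is maximized over all reports $(v_i,B_i)$ of bidder $i$ by $v_i=\eta_i$, $B_i=\beta_i$. (PO, ex post) For all reports, in every realization, $\sum_iX_i=m$, and if $X_i>0$ and $v_j>v_i$, then $v_i>B_j-P_j$. Moreover, the auction can be obtained as follows. On reports $(\vec v,\vec B)$, run the adaptive clinching auction for one infinitely divisible good with the valuations $mv_i$ and the budgets $B_i$; let $x_i\in[0,1]$ (with $\sum_i x_i=1$)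 be the allocations and $\pi_i\in[0,B_i]$ the total prices that it yields. Give all $m$ units to bidder $i$ with probability $x_i$, and charge bidder $i$ the price $B_i$ with probability $\pi_i/B_i$ and the price $0$ with probability $1-\pi_i/B_i$. Here the adaptive clinching auction with valuations $w_i$ and budgets $B_i$ is the following process in time $t$, with unit price $p$, allocations $x_i$, payments $\pi_i$ and effective budgets $b_i$. All of these are continuous in $t$ up to the stopping time, and derivatives are right derivatives. Initially $p=x_i=\pi_i=0$ and $b_i=B_i$. Let $S=1-\sum_ix_i$, $D_i=b_i/p$ (infinite at $p=0$ if $b_i>0$), $A=\{i: w_i>p,\ b_i>0\}$, $E=\{i: w_i=p,\ b_i>0\}$ and $C=\{i\in A: S=\sum_{j\ne i}D_j\}$. The process stops at the first time $f$ at which $\sum_{i\in A}D_i\le S$. Before $f$, if $E=\emptyset$, then $p'=1$, and for each $i\in C$, $\pi_i'=-b_i'=S$ and $x_i'=S/p$; if $E\ne\emptyset$, then $p'=0$, $b_j'=-1$ for the smallest index $j\in E$, and for each $i\in C$, $\pi_i'=-b_i'=1$ and $x_i'=1/p$; all other derivatives are $0$. At time $f$, at the unit price $p(f)$, each $i\in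 A$ buys the amount $D_i$, and the remaining supply $S-\sum_{i\in A}D_i$ is sold to the bidders in $E$ within their effective budgets. -/

import Mathlib

open scoped ENNReal

noncomputable section

namespace BudgetAuction

/-! ### Randomized auctions of `m` indivisible units to `n` budget-constrained bidders -/

/-- A realized outcome: the number of units each bidder gets and the total price each bidder
pays. -/
structure Outcome (n : ℕ) where
  units : Fin n → ℕ
  pay : Fin n → ℝ

/-- A randomized auction maps the reported valuations (per unit) `v` and the reported budgets `B`
to a probability distribution over outcomes. -/
abbrev RandomizedAuction (n : ℕ) : Type :=
  (v B : Fin n → ℝ) → PMF (Outcome n)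

/-- Profiles of (reported or true) types: all valuations and all budgets are positive. -/
def IsProfile {n : ℕ} (v B : Fin n → ℝ) : Prop :=
  ∀ i, 0 < v i ∧ 0 < B i

/-- Realized utility of bidder `i` with true valuation `η` per unit and true budget `β`: it is
`-∞` if the total price exceeds the true budget. -/
def utility {n : ℕ} (η β : ℝ) (i : Fin n) (o : Outcome n) : EReal :=
  if β < o.pay i then ⊥ else ((η * (o.units i : ℝ) - o.pay i : ℝ) : EReal)

/-- Expectation of an extended-real random variable under a discrete law: expectation of the
positive part minus expectation of the negative part. -/
def expectation {α : Type*} (μ : PMF α) (u : α → EReal) : EReal :=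
  ((∑' a, μ a * (u a).toENNReal : ℝ≥0∞) : EReal) -
    ((∑' a, μ a * (-(u a)).toENNReal : ℝ≥0∞) : EReal)

/-- Expected utility, over the randomness of the mechanism. -/
def expectedUtility {n : ℕ} (η β : ℝ) (i : Fin n) (μ : PMF (Outcome n)) : EReal :=
  expectation μ (utility η β i)

/-- No Positive Transfers, in every realization. -/
def NoPositiveTransfers {n : ℕ} (M : RandomizedAuction n) : Prop :=
  ∀ v B, IsProfile v B → ∀ o ∈ (M v B).support, ∀ i, 0 ≤ o.pay i

/-- Voluntary Participation in expectation: a bidder who reports truthfully has nonnegative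
expected utility, whatever the others report. -/
def VoluntaryParticipation {n : ℕ} (M : RandomizedAuction n) : Prop :=
  ∀ v B, IsProfile v B → ∀ i, 0 ≤ expectedUtility (v i) (B i) i (M v B)

/-- Incentive Compatibility in expectation: for a bidder `i` with true type `(v i, B i)`, whatever
the others report, no joint misreport `(v', B')` has a larger expected utility than the truth. -/
def IncentiveCompatible {n : ℕ} (M : RandomizedAuction n) : Prop :=
  ∀ v B, IsProfile v B → ∀ (i : Fin n) (v' B' : ℝ), 0 < v' → 0 < B' →
    expectedUtility (v i) (B i) i (M (Function.update v i v') (Function.update B i B')) ≤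
      expectedUtility (v i) (B i) i (M v B)

/-- Pareto-optimality for `m` indivisible units, in every realization: all units are sold, and if
`i` gets a unit and `j` has a larger valuation, then what is left of `j`'s budget is less than
`i`'s valuation. -/
def ParetoOptimal {n : ℕ} (m : ℕ) (M : RandomizedAuction n) : Prop :=
  ∀ v B, IsProfile v B → ∀ o ∈ (M v B).support,
    ∑ i, o.units i = m ∧
      ∀ i j, 0 < o.units i → v i < v j → B j - o.pay j < v i

/-! ### The adaptive clinching auction for one infinitely divisible good -/

/-- The state of the auction at one time: unit price, quantity allocated so far to each bidder,
price extracted so far from each bidder, and effective budget of each bidder. -/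
structure State (n : ℕ) where
  price : ℝ
  alloc : Fin n → ℝ
  paid : Fin n → ℝ
  budget : Fin n → ℝ

namespace State

variable {n : ℕ}

/-- The quantity of the good that is left. -/
def supply (s : State n) : ℝ := 1 - ∑ i, s.alloc i

/-- Active bidders. -/
def active (v : Fin n → ℝ) (s : State n) : Finset (Fin n) :=
  Finset.univ.filter fun i => s.price < v i ∧ 0 < s.budget i

/-- Exiting bidders. -/
def exiting (v : Fin n → ℝ) (s : State n) : Finset (Fin n) :=
  Finset.univ.filter fun i => v i = s.price ∧ 0 < s.budget i

/-- Clinching bidders: active bidders for whom the total demand of the others equals the supply.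
The demand of a bidder is `budget / price`; the equation is multiplied by the price, so that it
has the right meaning at the initial price `0`, where positive budgets mean infinite demand. -/
def clinching (v : Fin n → ℝ) (s : State n) : Finset (Fin n) :=
  (s.active v).filter fun i => ∑ j ∈ Finset.univ.erase i, s.budget j = s.price * s.supply

/-- The stopping condition: the total demand of the active bidders is at most the supply (again
multiplied by the price). -/
def Stops (v : Fin n → ℝ) (s : State n) : Prop :=
  ∑ i ∈ s.active v, s.budget i ≤ s.price * s.supply

/-- The price rises at unit rate, and rests while there are exiting bidders. -/
def priceRate (v : Fin n → ℝ) (s : State n) : ℝ :=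
  if s.exiting v = ∅ then 1 else 0

/-- The rate at which money is extracted from each clinching bidder. -/
def extractionRate (v : Fin n → ℝ) (s : State n) : ℝ :=
  if s.exiting v = ∅ then s.supply else 1

/-- The rate of the price paid by bidder `i`. -/
def paidRate (v : Fin n → ℝ) (s : State n) (i : Fin n) : ℝ :=
  if i ∈ s.clinching v then s.extractionRate v else 0

/-- The rate of the allocation of bidder `i`, bought at the current unit price. -/
def allocRate (v : Fin n → ℝ) (s : State n) (i : Fin n) : ℝ :=
  if i ∈ s.clinching v then s.extractionRate v / s.price else 0

/-- The rate of the effective budget of bidder `i`: clinching bidders lose what they pay, and the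
exiting bidder with the smallest index, if there is one, loses effective budget at unit rate. -/
def budgetRate (v : Fin n → ℝ) (s : State n) (i : Fin n) : ℝ :=
  if i ∈ s.clinching v then -s.extractionRate v
  else if i ∈ s.exiting v ∧ ∀ j ∈ s.exiting v, i ≤ j then -1 else 0

end State

/-- `s` is the run of the adaptive clinching auction with reports `v`, `B`, and `f` is its stopping
time: the state evolves continuously from its initial value, with the prescribed (right)
derivatives, up to the first time at which the stopping condition holds. `s f` is the state
immediately before the final one-shot allocations. -/
structure IsClinchingRun {n : ℕ} (v B : Fin n → ℝ) (s : ℝ → State n) (f : ℝ) : Prop where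
  stop_nonneg : 0 ≤ f
  price_zero : (s 0).price = 0
  alloc_zero : ∀ i, (s 0).alloc i = 0
  paid_zero : ∀ i, (s 0).paid i = 0
  budget_zero : ∀ i, (s 0).budget i = B i
  price_cont : ContinuousOn (fun t => (s t).price) (Set.Icc 0 f)
  alloc_cont : ∀ i, ContinuousOn (fun t => (s t).alloc i) (Set.Icc 0 f)
  paid_cont : ∀ i, ContinuousOn (fun t => (s t).paid i) (Set.Icc 0 f)
  budget_cont : ∀ i, ContinuousOn (fun t => (s t).budget i) (Set.Icc 0 f)
  not_stops : ∀ t ∈ Set.Ico 0 f, ¬ (s t).Stops v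
  stops : (s f).Stops v
  price_deriv : ∀ t ∈ Set.Ico 0 f,
    HasDerivWithinAt (fun t => (s t).price) ((s t).priceRate v) (Set.Ici t) t
  alloc_deriv : ∀ t ∈ Set.Ico 0 f, ∀ i,
    HasDerivWithinAt (fun t => (s t).alloc i) ((s t).allocRate v i) (Set.Ici t) t
  paid_deriv : ∀ t ∈ Set.Ico 0 f, ∀ i,
    HasDerivWithinAt (fun t => (s t).paid i) ((s t).paidRate v i) (Set.Ici t) t
  budget_deriv : ∀ t ∈ Set.Ico 0 f, ∀ i,
    HasDerivWithinAt (fun t => (s t).budget i) ((s t).budgetRate v i) (Set.Ici t) t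

/-- `X`, `P` result from the state `s` by the final one-shot allocations at the current unit price:
every active bidder buys her demand, and the rest of the supply is sold to the exiting bidders
within their budgets. -/
structure IsFinalAllocation {n : ℕ} (v : Fin n → ℝ) (s : State n) (X P : Fin n → ℝ) : Prop where
  total : ∑ i, X i = 1
  price_eq : ∀ i, P i = s.paid i + s.price * (X i - s.alloc i)
  active_eq : ∀ i ∈ s.active v, X i = s.alloc i + s.budget i / s.price
  exiting_mem : ∀ i ∈ s.exiting v,
    s.alloc i ≤ X i ∧ s.price * (X i - s.alloc i) ≤ s.budget i
  other_eq : ∀ i, i ∉ s.active v → i ∉ s.exiting v → X i = s.alloc i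

/-- `X`, `P` are total allocations and total prices of the (deterministic) adaptive clinching
auction of one infinitely divisible good with reports `v`, `B`. -/
def IsClinchingOutcome {n : ℕ} (v B X P : Fin n → ℝ) : Prop :=
  ∃ (s : ℝ → State n) (f : ℝ), IsClinchingRun v B s f ∧ IsFinalAllocation v (s f) X P

/-! ### The randomized auction of `m` units obtained from it -/

/-- The allocation in which bidder `i` gets all `m` units. -/
def allTo {n : ℕ} (m : ℕ) (i : Fin n) : Fin n → ℕ :=
  fun j => if j = i then m else 0

/-- The random outcome `μ` gives all `m` units to bidder `i` with probability `X i`, and extracts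
from bidder `i` the reported budget `B i` with probability `P i / B i` and the price zero
otherwise. -/
structure IsLottery {n : ℕ} (m : ℕ) (B X P : Fin n → ℝ) (μ : PMF (Outcome n)) : Prop where
  units_law : ∀ i, (μ.map fun o => o.units) (allTo m i) = ENNReal.ofReal (X i)
  pay_budget : ∀ i, (μ.map fun o => o.pay i) (B i) = ENNReal.ofReal (P i / B i)
  pay_zero : ∀ i, (μ.map fun o => o.pay i) 0 = ENNReal.ofReal (1 - P i / B i)

/-- `M` runs the adaptive clinching auction of one infinitely divisible good with the valuations
scaled up by the factor `m`, randomizes the price extraction, and gives all `m` units to one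
bidder, drawn with the allocated fractions as probabilities. -/
def RunsScaledClinching {n : ℕ} (m : ℕ) (M : RandomizedAuction n) : Prop :=
  ∀ v B, IsProfile v B → ∃ X P : Fin n → ℝ,
    IsClinchingOutcome (fun i => (m : ℝ) * v i) B X P ∧ IsLottery m B X P (M v B)

end BudgetAuction

end

open Set Filter Topology MeasureTheory
open scoped ENNReal

/-! The process has one degree of freedom. At unit price `p` the effective budget of every remaining
bidder is `min (B i) y` for one common cap `y`; the clinching bidders are those with budget at least
`y`, and the unsold supply `S` satisfies `p * S = D(y) - y`, where `D(y)` is the sum of the capped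
budgets (`demand`). Between exits the rules say `y' = -S = -(D(y) - y) / p`. At a valuation where
bidders exit, `y` drops by their capped budgets, cut off at `0`; the value `0` means that the
auction is over. Existence of this scalar path (`exists_isPath`) is Picard–Lindelöf between exits
plus induction on the number of remaining bidders, and the run of the auction is rebuilt from it. A
bidder who exits before the end has bought nothing.

Incentives are read off the path. A bidder who has spent `π p` up to price `p`, buying each
increment at the current price, holds `∫ π / q ^ 2 + π p / p` by integration by parts. Hence the
truthful utility at valuation `w` is `w` times the integral of `π / q ^ 2` up to `w`. Below the
reported valuation the path does not depend on the report (`IsPath.eq_of_lt`), so a false valuation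
merely stops the purchases at another price, and monotonicity of `π` makes the true one best
(`IsSpending.add_le_surplus`). A smaller reported budget lowers `π` pointwise (`IsPath.le_add`,
`spent_mono`) and hence the integral. A larger reported budget is useless because of the lottery: a
positive price means that the full reported budget is charged with positive probability, so the
expected utility is `-∞`; a zero price comes with no goods. The lottery keeps expectations linear,
so valuation `η` per unit acts as valuation `m * η` for the divisible good.

For Pareto optimality, the cap cannot reach `0` between exits (`IsPath.pos_of_flow`), so the auction
ends at the valuation `q` of some bidders. Those below `q` get nothing, those above `q` spend their
whole budgets. If `i` can win, every bidder with a larger valuation has `P j = B j`, and then the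
lottery charges her `B j` in every realization. `exists_outcome` collects these facts. -/

namespace BudgetAuction

/-! ### Right derivatives: a comparison principle with jumps, and gluing of flows. -/

section
/-- A function that starts nonpositive, whose right derivative is nonpositive wherever it is
positive, and which has no upward jumps to positive values, stays nonpositive. -/
theorem nonpos_of_rightDeriv {a b : ℝ} {g g' : ℝ → ℝ} (h0 : g a ≤ 0)
    (hd : ∀ p ∈ Ico a b, HasDerivWithinAt g (g' p) (Ici p) p)
    (hpos : ∀ p ∈ Ico a b, 0 < g p → g' p ≤ 0)
    (hjump : ∀ q ∈ Ioc a b, ∃ l, Tendsto g (𝓝[<] q) (𝓝 l) ∧ g q ≤ max 0 l) :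
    ∀ p ∈ Icc a b, g p ≤ 0 := by
  -- The barrier has slope `ε` and is strictly positive from `a` on. Hence `g` is positive wherever
  -- it touches the barrier, `hpos` applies there, and its right derivative is below `ε`.
  suffices H : ∀ ε > 0, ∀ p ∈ Icc a b, g p ≤ ε * (1 + p - a) by
    intro p hp
    refine le_of_forall_pos_le_add fun δ hδ => ?_
    have h1 : 0 < 1 + p - a := by linarith [hp.1]
    have := H (δ / (1 + p - a)) (div_pos hδ h1) p hp
    rwa [div_mul_cancel₀ _ h1.ne', ← zero_add δ] at this
  intro ε hε
  set s : Set ℝ := {p | ∀ q ∈ Icc a p, g q ≤ ε * (1 + q - a)} with hs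
  have hsub : Icc a b ⊆ s := by
    apply IsClosed.Icc_subset_of_forall_exists_gt
    · apply isClosed_of_closure_subset
      intro p hp
      have hpI : p ∈ Icc a b :=
        closure_minimal (inter_subset_right) isClosed_Icc hp
      refine ⟨?_, hpI⟩
      have hlt : ∀ q ∈ Ico a p, g q ≤ ε * (1 + q - a) := by
        intro q hq
        obtain ⟨z, hz, hzs⟩ := mem_closure_iff.1 hp (Ioi q) isOpen_Ioi hq.2
        exact hzs.1 q ⟨hq.1, (mem_Ioi.1 hz).le⟩
      intro q hq
      rcases hq.2.lt_or_eq with h | rfl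
      · exact hlt q ⟨hq.1, h⟩
      rcases hq.1.eq_or_lt with rfl | h
      · have : 0 ≤ ε * (1 + a - a) := by nlinarith
        linarith
      · obtain ⟨l, hl, hgl⟩ := hjump q ⟨h, hpI.2⟩
        have hle : l ≤ ε * (1 + q - a) := by
          refine le_of_tendsto hl ?_
          filter_upwards [Ico_mem_nhdsLT h] with z hz
          refine (hlt z hz).trans ?_
          have := hz.2
          gcongr
        refine hgl.trans (max_le ?_ hle)
        have : 0 ≤ 1 + q - a := by linarith
        positivity
    · intro q hq
      have : q = a := le_antisymm hq.2 hq.1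
      subst this
      have : 0 ≤ ε * (1 + q - q) := by nlinarith
      linarith
    · rintro x ⟨hxs, hx⟩ y hy
      have hgx : g x ≤ ε * (1 + x - a) := hxs x ⟨hx.1, le_rfl⟩
      have hev : ∀ᶠ z in 𝓝[>] x, g z ≤ ε * (1 + z - a) := by
        rcases hgx.lt_or_eq with h | h
        · have hc : Tendsto (fun z => g z - ε * (1 + z - a)) (𝓝[>] x)
              (𝓝 (g x - ε * (1 + x - a))) := by
            have h1 : ContinuousWithinAt g (Ioi x) x :=
              (hd x hx).continuousWithinAt.mono Ioi_subset_Ici_self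
            have h2 : ContinuousWithinAt (fun z => ε * (1 + z - a)) (Ioi x) x := by fun_prop
            exact (h1.sub h2)
          filter_upwards [hc.eventually (gt_mem_nhds (show _ < (0:ℝ) by linarith))] with z hz
          linarith
        · have hp : 0 < g x := by
            rw [h]; have : 0 < 1 + x - a := by linarith [hx.1]
            positivity
          have := (hd x hx).limsup_slope_le (lt_of_le_of_lt (hpos x hx hp) hε)
          rw [Ici_sdiff_left] at this
          filter_upwards [this, self_mem_nhdsWithin] with z hz hzx
          have hzx' : 0 < z - x := sub_pos.2 hzx
          rw [slope_def_field, div_lt_iff₀ hzx'] at hz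
          nlinarith
      obtain ⟨u, hu, hus⟩ := mem_nhdsGT_iff_exists_Ioc_subset.1 hev
      refine ⟨min u y, ?_, lt_min hu hy, min_le_right _ _⟩
      intro q hq
      rcases le_or_gt q x with h | h
      · exact hxs q ⟨hq.1, h⟩
      · exact hus ⟨h, hq.2.trans (min_le_left _ _)⟩
  exact fun p hp => hsub hp p ⟨hp.1, le_rfl⟩

/-- Continuity on `[a, b]` together with the right derivative `r` on `[a, b)`. -/
structure RightFlow (g r : ℝ → ℝ) (a b : ℝ) : Prop where
  cont : ContinuousOn g (Icc a b)
  deriv : ∀ t ∈ Ico a b, HasDerivWithinAt g (r t) (Ici t) t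

theorem rightFlow_refl (g r : ℝ → ℝ) (a : ℝ) : RightFlow g r a a :=
  ⟨by simp, by simp⟩

theorem HasDerivWithinAt.congr_Ici {g h : ℝ → ℝ} {d t b : ℝ} (hg : HasDerivWithinAt g d (Ici t) t)
    (htb : t < b) (he : ∀ z ∈ Ico t b, h z = g z) : HasDerivWithinAt h d (Ici t) t := by
  refine hg.congr_of_eventuallyEq ?_ (he t ⟨le_rfl, htb⟩)
  filter_upwards [Ico_mem_nhdsGE htb] with z hz using he z hz

theorem RightFlow.congr {g r h r' : ℝ → ℝ} {a b : ℝ} (H : RightFlow g r a b)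
    (hg : ∀ t ∈ Icc a b, h t = g t) (hr : ∀ t ∈ Ico a b, r' t = r t) : RightFlow h r' a b := by
  refine ⟨H.cont.congr hg, fun t ht => ?_⟩
  rw [hr t ht]
  exact HasDerivWithinAt.congr_Ici (H.deriv t ht) ht.2
    fun z hz => hg z ⟨ht.1.trans hz.1, hz.2.le⟩

theorem RightFlow.glue {g₁ g₂ r₁ r₂ : ℝ → ℝ} {a b c : ℝ} (hab : a ≤ b) (hbc : b ≤ c)
    (h₁ : RightFlow g₁ r₁ a b) (h₂ : RightFlow g₂ r₂ b c) (he : g₁ b = g₂ b) :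
    RightFlow (fun t => if t < b then g₁ t else g₂ t) (fun t => if t < b then r₁ t else r₂ t)
      a c := by
  constructor
  · have e1 : ContinuousOn (fun t => if t < b then g₁ t else g₂ t) (Icc a b) := by
      refine h₁.cont.congr fun t ht => ?_
      rcases ht.2.lt_or_eq with h | rfl
      · simp [h]
      · simp [he]
    have e2 : ContinuousOn (fun t => if t < b then g₁ t else g₂ t) (Icc b c) := by
      refine h₂.cont.congr fun t ht => ?_
      simp [ht.1]
    rw [← Icc_union_Icc_eq_Icc hab hbc]
    exact e1.union_of_isClosed e2 isClosed_Icc isClosed_Icc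
  · intro t ht
    by_cases htb : t < b
    · simp only [htb, if_true]
      refine HasDerivWithinAt.congr_Ici (h₁.deriv t ⟨ht.1, htb⟩) htb fun z hz => ?_
      simp [hz.2]
    · simp only [htb, if_false]
      refine HasDerivWithinAt.congr_Ici (h₂.deriv t ⟨not_lt.1 htb, ht.2⟩) ht.2 fun z hz => ?_
      simp [(not_lt.1 htb).trans hz.1]

/-- The right derivative of `min c (y ·)` for an antitone `y`. -/
theorem hasDerivWithinAt_min_const {y : ℝ → ℝ} {d t b c : ℝ} (htb : t < b)
    (hy : HasDerivWithinAt y d (Ici t) t) (hanti : ∀ z ∈ Ico t b, y z ≤ y t) :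
    HasDerivWithinAt (fun z => min c (y z)) (if y t ≤ c then d else 0) (Ici t) t := by
  split_ifs with h
  · exact HasDerivWithinAt.congr_Ici hy htb fun z hz => min_eq_right ((hanti z hz).trans h)
  · have hc : ∀ᶠ z in 𝓝[≥] t, c < y z :=
      hy.continuousWithinAt.eventually (lt_mem_nhds (not_le.1 h))
    refine (hasDerivWithinAt_const t (Ici t) c).congr_of_eventuallyEq ?_ ?_
    · filter_upwards [hc] with z hz using min_eq_left hz.le
    · exact min_eq_left (not_le.1 h).le

end

/-! ### The capped demand, its invariant, and the differential equation of the cap. -/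

section
variable {ι : Type*}

/-- The total effective budget of the bidders in `G` when every budget is capped at `y`. -/
noncomputable def demand (B : ι → ℝ) (G : Finset ι) (y : ℝ) : ℝ := ∑ j ∈ G, min (B j) y

section demand
variable {B : ι → ℝ} {G : Finset ι} {y z : ℝ}

theorem demand_mono (h : y ≤ z) : demand B G y ≤ demand B G z :=
  Finset.sum_le_sum fun _ _ => min_le_min_left _ h

theorem demand_nonneg (hB : ∀ j, 0 < B j) (h : 0 ≤ y) : 0 ≤ demand B G y :=
  Finset.sum_nonneg fun j _ => le_min (hB j).le h

theorem demand_zero (hB : ∀ j, 0 < B j) : demand B G 0 = 0 :=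
  Finset.sum_eq_zero fun j _ => min_eq_right (hB j).le

theorem demand_eq_sum (h : ∀ j ∈ G, B j ≤ y) : demand B G y = ∑ j ∈ G, B j :=
  Finset.sum_congr rfl fun j hj => min_eq_left (h j hj)

theorem demand_le_card : demand B G y ≤ G.card * y := by
  rw [← nsmul_eq_mul]
  exact Finset.sum_le_card_nsmul _ _ _ fun j _ => min_le_right _ _

theorem demand_erase [DecidableEq ι] {i : ι} (hi : i ∈ G) :
    demand B G y = demand B (G.erase i) y + min (B i) y :=
  (Finset.sum_erase_add _ _ hi).symm

theorem min_le_demand (hB : ∀ j, 0 < B j) (h : 0 ≤ y) {i : ι} (hi : i ∈ G) :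
    min (B i) y ≤ demand B G y :=
  Finset.single_le_sum (f := fun j => min (B j) y) (fun j _ => le_min (hB j).le h) hi

theorem abs_min_sub_min_const_le (c y z : ℝ) : |min c y - min c z| ≤ |y - z| := by
  have := abs_min_sub_min_le_max c y c z
  simpa using this

theorem abs_demand_sub_le : |demand B G y - demand B G z| ≤ G.card * |y - z| := by
  rw [demand, demand, ← Finset.sum_sub_distrib, ← nsmul_eq_mul]
  exact (Finset.abs_sum_le_sum_abs _ _).trans
    (Finset.sum_le_card_nsmul _ _ _ fun j _ => abs_min_sub_min_const_le _ _ _)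

/-- Below the largest budget, the demand grows at least as fast as the cap. -/
theorem demand_sub_mono {j : ι} (hj : j ∈ G) (hyz : z ≤ y) (hy : y ≤ B j) :
    demand B G z - z ≤ demand B G y - y := by
  classical
  rw [demand_erase hj, demand_erase hj, min_eq_right hy, min_eq_right (hyz.trans hy)]
  have := demand_mono (B := B) (G := G.erase j) hyz
  linarith

end demand

/-- The invariant of the clinching auction at unit price `p` when the budgets of the bidders in `G`
are capped at `y`: the value `demand B G y - y` of the unsold supply is at most `p`, and nothing has
been sold as long as the cap is above all budgets. -/
structure Balanced (B : ι → ℝ) (G : Finset ι) (p y : ℝ) : Prop where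
  nonneg : 0 ≤ y
  le_price : demand B G y - y ≤ p
  cases : demand B G y - y = p ∨ y = 0 ∨ ∃ j ∈ G, y ≤ B j

/-- If some budget is at least the cap, the term of that bidder alone compensates the subtracted
`y`. -/
theorem Balanced.supply_nonneg {B : ι → ℝ} {G : Finset ι} {p y : ℝ} (h : Balanced B G p y)
    (hB : ∀ j, 0 < B j) (hp : 0 ≤ p) : 0 ≤ demand B G y - y := by
  rcases h.cases with h1 | h1 | ⟨j, hj, h1⟩
  · linarith
  · rw [h1, demand_zero hB]; simp
  · have := min_le_demand hB h.nonneg hj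
    rw [min_eq_right h1] at this; linarith

/-- Bidders leave: their total capped budget is taken off the cap. -/
theorem Balanced.exit [DecidableEq ι] {B : ι → ℝ} {G E : Finset ι} {p l : ℝ}
    (hB : ∀ j, 0 < B j) (hp : 0 ≤ p) (hd : Disjoint G E) (h : Balanced B (G ∪ E) p l) :
    Balanced B G p (max 0 (l - demand B E l)) := by
  rcases le_or_gt (l - demand B E l) 0 with h0 | h0
  · rw [max_eq_left h0]
    exact ⟨le_rfl, by rw [demand_zero hB]; simpa using hp, Or.inr (Or.inl rfl)⟩
  rw [max_eq_right h0.le]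
  -- If a positive cap survives the exit, no exiting bidder had a budget reaching the cap.
  have hE : ∀ j ∈ E, B j < l := by
    intro j hj
    by_contra hc
    have := min_le_demand hB h.nonneg hj
    rw [min_eq_right (not_lt.1 hc)] at this
    linarith
  have hE0 : 0 ≤ demand B E l := demand_nonneg hB h.nonneg
  have hun : demand B (G ∪ E) l = demand B G l + demand B E l := Finset.sum_union hd
  have hm : demand B G (l - demand B E l) ≤ demand B G l := demand_mono (by linarith)
  refine ⟨h0.le, ?_, ?_⟩
  · have := h.le_price
    linarith
  · by_cases hj : ∃ j ∈ G, l - demand B E l ≤ B j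
    · exact Or.inr (Or.inr hj)
    push Not at hj
    -- When the new cap exceeds all remaining budgets, so did the old one, and by `hE` it exceeded
    -- the leaving ones too. Only the case that nothing has been sold is left, and with all budgets
    -- uncapped the equality persists.
    rcases h.cases with h1 | h1 | ⟨j, hj', h1⟩
    · left
      rw [demand_eq_sum fun j hj' => (hj j hj').le]
      rw [hun, demand_eq_sum (G := G) fun j hj' => ((hj j hj').le.trans (by linarith))] at h1
      linarith
    · linarith
    · rcases Finset.mem_union.1 hj' with h2 | h2
      · have := hj j h2; linarith
      · have := hE j h2; linarith

/-- With a larger cap and larger budgets, less of the good has been sold. -/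
theorem Balanced.supply_mono [DecidableEq ι] {B B' : ι → ℝ} {G : Finset ι} {p y y' : ℝ} {i : ι}
    (hB : ∀ j, 0 < B j) (hi : i ∈ G) (hne : ∀ j, j ≠ i → B' j = B j)
    (hle : B' i ≤ B i) (h : Balanced B G p y) (h' : Balanced B' G p y') (hy : y' ≤ y) :
    demand B' G y' - y' ≤ demand B G y - y := by
  have he : ∀ z, demand B' (G.erase i) z = demand B (G.erase i) z := fun z =>
    Finset.sum_congr rfl fun j hj => by rw [hne j (Finset.ne_of_mem_erase hj)]
  -- Either another bidder has a budget reaching the cap `y`, or `i` has, or nobody has. In the last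
  -- case the unsold value is `p`, an upper bound for every balanced cap.
  by_cases hj : ∃ j ∈ G.erase i, y ≤ B j
  · obtain ⟨j, hj, hyj⟩ := hj
    have := demand_sub_mono hj hy hyj
    rw [demand_erase hi, demand_erase hi, he]
    have := min_le_min hle hy
    linarith
  push Not at hj
  rcases le_or_gt y (B i) with hyi | hyi
  · have h1 := demand_mono (B := B) (G := G.erase i) hy
    rw [demand_erase hi, demand_erase hi, he, min_eq_right hyi]
    have := min_le_right (B' i) y'
    linarith
  · rcases h.cases with h1 | h1 | ⟨j, hj', h1⟩
    · rw [h1]; exact h'.le_price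
    · have := hB i; linarith
    · by_cases hji : j = i
      · subst hji; linarith
      · have := hj j (Finset.mem_erase.2 ⟨hji, hj'⟩); linarith

/-- While the cap is at most the largest budget, it follows the differential equation of the
clinching auction. -/
theorem exists_flow {B : ι → ℝ} (hB : ∀ j, 0 < B j) (G : Finset ι) {a q y₀ : ℝ} (ha : 0 < a)
    (haq : a ≤ q) (hy₀ : 0 ≤ y₀) {j : ι} (hj : j ∈ G) (hyj : y₀ ≤ B j)
    (hW : demand B G y₀ - y₀ ≤ a) :
    ∃ g : ℝ → ℝ, g a = y₀ ∧ RightFlow g (fun p => -((demand B G (g p) - g p) / p)) a q ∧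
      ∀ p ∈ Icc a q, Balanced B G p (g p) := by
  -- Clamping the rate to `[0, 1]` makes the field bounded by `1` and globally Lipschitz in `y`, so
  -- the solution reaches `q`. The bounds proved below show that the clamp is never active on it.
  set f : ℝ → ℝ → ℝ := fun p y => -max 0 (min 1 ((demand B G y - y) / p)) with hf
  have hPL : IsPicardLindelof f (tmin := a) (tmax := q) ⟨a, le_rfl, haq⟩ y₀
      ⟨q - a, sub_nonneg.2 haq⟩ 0 1 ⟨(G.card + 1) / a, by positivity⟩ := by
    constructor
    · intro t ht
      refine LipschitzOnWith.of_dist_le_mul fun y _ z _ => ?_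
      have ht0 : 0 < t := ha.trans_le ht.1
      simp only [hf, Real.dist_eq]
      have h1 : |(demand B G y - y) / t - (demand B G z - z) / t| ≤
          (G.card + 1) / a * |y - z| := by
        rw [← sub_div, abs_div, abs_of_pos ht0]
        have e : demand B G y - y - (demand B G z - z) =
          (demand B G y - demand B G z) - (y - z) := by ring
        have h2 : |demand B G y - y - (demand B G z - z)| ≤ (G.card + 1) * |y - z| := by
          rw [e]
          refine (abs_sub _ _).trans ?_
          have := abs_demand_sub_le (B := B) (G := G) (y := y) (z := z)
          linarith
        calc _ ≤ (G.card + 1) * |y - z| / t := by gcongr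
          _ ≤ (G.card + 1) * |y - z| / a := by gcongr; exact ht.1
          _ = _ := by ring
      refine le_trans ?_ h1
      rw [← abs_neg]
      have e2 : ∀ u w : ℝ, |max 0 (min 1 u) - max 0 (min 1 w)| ≤ |u - w| := by
        intro u w
        have h3 := abs_max_sub_max_le_max 0 (min 1 u) 0 (min 1 w)
        have h4 := abs_min_sub_min_const_le 1 u w
        simp only [sub_self, abs_zero] at h3
        exact h3.trans (max_le (abs_nonneg _) h4)
      refine le_trans (le_of_eq ?_) (e2 _ _)
      congr 1; ring
    · intro y _
      have : ContinuousOn (fun t : ℝ => (demand B G y - y) / t) (Icc a q) :=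
        continuousOn_const.div continuousOn_id fun t ht => (ha.trans_le ht.1).ne'
      have hc : Continuous fun u : ℝ => -max 0 (min 1 u) := by fun_prop
      exact hc.comp_continuousOn this
    · intro t _ y _
      rw [hf, norm_neg, Real.norm_eq_abs, abs_of_nonneg (le_max_left _ _)]
      exact max_le (by simp) (min_le_left _ _)
    · simp only [NNReal.coe_one, one_mul, sub_self, NNReal.coe_zero, sub_zero]
      exact max_le le_rfl (sub_nonneg.2 haq)
  obtain ⟨g, hga, hg⟩ := hPL.exists_eq_forall_mem_Icc_hasDerivWithinAt₀
  have hcont : ContinuousOn g (Icc a q) := fun t ht => (hg t ht).continuousWithinAt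
  have hder : ∀ t ∈ Ico a q, HasDerivWithinAt g (f t (g t)) (Ici t) t := fun t ht =>
    (hg t ⟨ht.1, ht.2.le⟩).mono_of_mem_nhdsWithin
      (mem_of_superset (Icc_mem_nhdsGE ht.2) (Icc_subset_Icc_left ht.1))
  have hlim : ∀ t ∈ Ioc a q, Tendsto g (𝓝[<] t) (𝓝 (g t)) := fun t ht =>
    (hcont t ⟨ht.1.le, ht.2⟩).mono_left (nhdsWithin_le_of_mem
      (mem_of_superset (Ioo_mem_nhdsLT ht.1) fun z hz => ⟨hz.1.le, hz.2.le.trans ht.2⟩))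
  have hfle : ∀ t y, f t y ≤ 0 := fun t y => neg_nonpos.2 (le_max_left _ _)
  have hle : ∀ t ∈ Icc a q, g t ≤ y₀ := by
    have := nonpos_of_rightDeriv (a := a) (b := q) (g := fun t => g t - y₀)
      (g' := fun t => f t (g t)) (by simp; exact hga.le)
      (fun t ht => (hder t ht).sub_const _) (fun t _ _ => hfle _ _)
      (fun t ht => ⟨g t - y₀, (hlim t ht).sub_const _, le_max_right _ _⟩)
    intro t ht
    have := this t ht
    linarith
  have hge : ∀ t ∈ Icc a q, 0 ≤ g t := by
    have := nonpos_of_rightDeriv (a := a) (b := q) (g := fun t => -g t)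
      (g' := fun t => -f t (g t)) (by rw [hga]; simpa using hy₀)
      (fun t ht => (hder t ht).neg) (fun t ht h => ?_)
      (fun t ht => ⟨-g t, (hlim t ht).neg, le_max_right _ _⟩)
    · intro t ht
      have := this t ht
      linarith
    · have h' : g t ≤ 0 := by linarith
      have : demand B G (g t) - g t ≤ 0 := by
        have h1 := demand_sub_mono (B := B) hj h' (hB j).le
        rw [demand_zero hB] at h1; linarith
      have ht0 : 0 < t := ha.trans_le ht.1
      have h2 : (demand B G (g t) - g t) / t ≤ 0 := div_nonpos_of_nonpos_of_nonneg this ht0.le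
      simp only [hf, neg_neg]
      exact max_le le_rfl ((min_le_right _ _).trans h2)
  have hbal : ∀ p ∈ Icc a q, Balanced B G p (g p) := fun p hp =>
    ⟨hge p hp, by
      have := demand_sub_mono (B := B) hj (hle p hp) hyj
      linarith [hp.1], Or.inr (Or.inr ⟨j, hj, (hle p hp).trans hyj⟩)⟩
  refine ⟨g, hga, ⟨hcont, fun t ht => ?_⟩, hbal⟩
  have hb := hbal t ⟨ht.1, ht.2.le⟩
  have ht0 : 0 < t := ha.trans_le ht.1
  convert hder t ht using 1
  simp only [hf]
  rw [min_eq_right, max_eq_right]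
  · exact div_nonneg (hb.supply_nonneg hB ht0.le) ht0.le
  · rw [div_le_one ht0]; exact hb.le_price

end

/-! ### The path of the cap as a function of the price: existence. -/

section
variable {ι : Type*} [Fintype ι]

/-- The bidders with valuation above `p`. -/
noncomputable def above (v : ι → ℝ) (p : ℝ) : Finset ι := Finset.univ.filter fun j => p < v j

/-- The bidders with valuation `p`. -/
noncomputable def atVal (v : ι → ℝ) (p : ℝ) : Finset ι := Finset.univ.filter fun j => v j = p

@[simp] theorem mem_above {v : ι → ℝ} {p : ℝ} {j : ι} : j ∈ above v p ↔ p < v j := by simp [above]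

@[simp] theorem mem_atVal {v : ι → ℝ} {p : ℝ} {j : ι} : j ∈ atVal v p ↔ v j = p := by simp [atVal]

theorem disjoint_above_atVal (v : ι → ℝ) (p : ℝ) : Disjoint (above v p) (atVal v p) := by
  rw [Finset.disjoint_left]; intro j; simp; intro h1 h2; exact h1.ne' h2

/-- The cap on the effective budgets, as a function of the unit price, from price `a` on. At a
price at which bidders exit, it drops by their total effective budget; it is `0` from the final
price on. -/
structure IsPathFrom (v B : ι → ℝ) (a : ℝ) (y : ℝ → ℝ) : Prop where
  deriv : ∀ p, a ≤ p →
    HasDerivWithinAt y (-((demand B (above v p) (y p) - y p) / p)) (Ici p) p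
  jump : ∀ q, a < q → ∃ l, Tendsto y (𝓝[<] q) (𝓝 l) ∧ y q = max 0 (l - demand B (atVal v q) l)
  balanced : ∀ p, a ≤ p → Balanced B (above v p) p (y p)

section extend
variable {v B : ι → ℝ}

theorem tendsto_nhdsLT_of_continuousOn {g : ℝ → ℝ} {a b t : ℝ} (hg : ContinuousOn g (Icc a b))
    (ht : t ∈ Ioc a b) : Tendsto g (𝓝[<] t) (𝓝 (g t)) :=
  (hg t ⟨ht.1.le, ht.2⟩).mono_left (nhdsWithin_le_of_mem
    (mem_of_superset (Ioo_mem_nhdsLT ht.1) fun _ hz => ⟨hz.1.le, hz.2.le.trans ht.2⟩))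

theorem tendsto_nhdsLT_congr {g h : ℝ → ℝ} {a t l : ℝ} (hat : a < t) (hg : Tendsto g (𝓝[<] t) (𝓝 l))
    (he : ∀ z ∈ Ioo a t, h z = g z) : Tendsto h (𝓝[<] t) (𝓝 l) := by
  refine hg.congr' ?_
  filter_upwards [Ioo_mem_nhdsLT hat] with z hz using (he z hz).symm

/-- A path from price `q` on is extended to the left by a piece on which no bidder exits. -/
theorem IsPathFrom.extend {a q : ℝ} (haq : a < q) {g y : ℝ → ℝ} {G : Finset ι}
    (hG : ∀ p ∈ Ico a q, above v p = G)
    (hg : RightFlow g (fun p => -((demand B G (g p) - g p) / p)) a q)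
    (hbal : ∀ p ∈ Ico a q, Balanced B G p (g p)) (hy : IsPathFrom v B q y)
    (hq : y q = max 0 (g q - demand B (atVal v q) (g q))) :
    IsPathFrom v B a fun p => if p < q then g p else y p := by
  have hE : ∀ p ∈ Ioo a q, atVal v p = ∅ := by
    intro p hp
    ext j
    simp only [mem_atVal, Finset.notMem_empty, iff_false]
    intro hj
    have h1 : j ∈ above v a := by simp [hj, hp.1]
    rw [hG a ⟨le_rfl, haq⟩, ← hG p ⟨hp.1.le, hp.2⟩] at h1
    simp [hj] at h1
  refine ⟨fun p hp => ?_, fun p hp => ?_, fun p hp => ?_⟩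
  · by_cases h : p < q
    · simp only [h, if_true, hG p ⟨hp, h⟩]
      exact HasDerivWithinAt.congr_Ici (hg.deriv p ⟨hp, h⟩) h fun z hz => by simp [hz.2]
    · simp only [h, if_false]
      exact HasDerivWithinAt.congr_Ici (hy.deriv p (not_lt.1 h)) (lt_add_one p)
        fun z hz => by simp [(not_lt.1 h).trans hz.1]
  · rcases lt_trichotomy p q with h | rfl | h
    · refine ⟨g p, tendsto_nhdsLT_congr hp (tendsto_nhdsLT_of_continuousOn hg.cont ⟨hp, h.le⟩)
        fun z hz => by simp [hz.2.trans h], ?_⟩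
      simp only [h, if_true, hE p ⟨hp, h⟩, demand, Finset.sum_empty, sub_zero]
      exact (max_eq_right (hbal p ⟨hp.le, h⟩).nonneg).symm
    · refine ⟨g p, tendsto_nhdsLT_congr hp (tendsto_nhdsLT_of_continuousOn hg.cont ⟨hp, le_rfl⟩)
        fun z hz => by simp [hz.2], ?_⟩
      simpa using hq
    · obtain ⟨l, hl, he⟩ := hy.jump p h
      refine ⟨l, tendsto_nhdsLT_congr h hl fun z hz => by simp [hz.1.le], ?_⟩
      simpa [not_lt.2 h.le] using he
  · by_cases h : p < q
    · simp only [h, if_true, hG p ⟨hp, h⟩]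
      exact hbal p ⟨hp, h⟩
    · simp only [h, if_false]
      exact hy.balanced p (not_lt.1 h)

theorem isPathFrom_zero (hB : ∀ j, 0 < B j) {a : ℝ} (ha : 0 < a) :
    IsPathFrom v B a fun _ => 0 := by
  refine ⟨fun p hp => ?_, fun q hq => ⟨0, tendsto_const_nhds, ?_⟩, fun p hp => ?_⟩
  · simpa [demand_zero hB] using hasDerivWithinAt_const p (Ici p) (0 : ℝ)
  · simp [demand_zero hB]
  · exact ⟨le_rfl, by rw [demand_zero hB]; linarith, Or.inr (Or.inl rfl)⟩

/-- Before anything is sold, the cap falls at the rate of the price. -/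
theorem rightFlow_linear {ι : Type*} {B : ι → ℝ} {G : Finset ι} {a q c : ℝ} (ha : 0 < a)
    (h : ∀ j ∈ G, ∀ p ∈ Ico a q, B j ≤ c - p) (hc : ∑ j ∈ G, B j = c) :
    RightFlow (fun p => c - p) (fun p => -((demand B G (c - p) - (c - p)) / p)) a q := by
  refine ⟨by fun_prop, fun t ht => ?_⟩
  have ht0 : 0 < t := ha.trans_le ht.1
  rw [demand_eq_sum fun j hj => h j hj t ht, hc]
  have : -((c - (c - t)) / t) = -1 := by field_simp; ring
  rw [this]
  simpa using ((hasDerivAt_id t).const_sub c).hasDerivWithinAt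

/-- The next exit price is the smallest valuation above `a`; the strict drop in cardinality drives
the inductions on the number of remaining bidders. -/
theorem exists_next [DecidableEq ι] {a : ℝ} (h : (above v a).Nonempty) :
    ∃ q, a < q ∧ (∀ p ∈ Ico a q, above v p = above v a) ∧
      above v a = above v q ∪ atVal v q ∧
      (above v q).card < (above v a).card := by
  obtain ⟨j, hj, hmin⟩ := Finset.exists_min_image (above v a) v h
  rw [mem_above] at hj
  have hun : above v a = above v (v j) ∪ atVal v (v j) := by
    ext k
    simp only [mem_above, Finset.mem_union, mem_atVal]
    constructor
    · intro hk
      rcases (hmin k (mem_above.2 hk)).lt_or_eq with h1 | h1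
      · exact Or.inl h1
      · exact Or.inr h1.symm
    · rintro (h1 | h1)
      · exact hj.trans h1
      · rwa [h1]
  refine ⟨v j, hj, fun p hp => ?_, hun, ?_⟩
  · ext k
    simp only [mem_above]
    exact ⟨fun hk => hp.1.trans_lt hk, fun hk => hp.2.trans_le (hmin k (mem_above.2 hk))⟩
  · apply Finset.card_lt_card
    rw [Finset.ssubset_iff_of_subset (by rw [hun]; exact Finset.subset_union_left)]
    exact ⟨j, by simpa using hj, by simp⟩

/-- From every balanced configuration there is a path. -/
theorem exists_isPathFrom (hB : ∀ j, 0 < B j) (N : ℕ) :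
    ∀ (a y₀ : ℝ), 0 < a → (above v a).card ≤ N → Balanced B (above v a) a y₀ →
      ∃ y, y a = y₀ ∧ IsPathFrom v B a y := by
  classical
  induction N using Nat.strong_induction_on with
  | _ N ih =>
  intro a y₀ ha hN hbal
  rcases hbal.nonneg.eq_or_lt with h0 | h0
  · subst h0; exact ⟨fun _ => 0, rfl, isPathFrom_zero hB ha⟩
  -- With no bidder left, `Balanced` allows only `-y₀ = a` or `y₀ = 0`, both excluded.
  have hne : (above v a).Nonempty := by
    by_contra hne
    rw [Finset.not_nonempty_iff_eq_empty] at hne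
    have h := hbal.cases
    simp only [hne, demand, Finset.sum_empty, Finset.notMem_empty, false_and, exists_false,
      or_false] at h
    rcases h with h | h <;> linarith
  obtain ⟨q, haq, hG, hun, hcard⟩ := exists_next hne
  -- continuing from the next price at which bidders exit
  have jump : ∀ l, Balanced B (above v a) q l →
      ∃ y, y q = max 0 (l - demand B (atVal v q) l) ∧ IsPathFrom v B q y := by
    intro l hl
    rw [hun] at hl
    exact ih (above v q).card (hcard.trans_le hN) q _ (ha.trans haq) le_rfl
      (hl.exit hB (ha.trans haq).le (disjoint_above_atVal v q))
  -- the cap is at most the largest budget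
  have low : ∀ a' y', a ≤ a' → a' < q → Balanced B (above v a) a' y' →
      (∃ j ∈ above v a, y' ≤ B j) → ∃ y, y a' = y' ∧ IsPathFrom v B a' y := by
    rintro a' y' haa' ha'q hb' ⟨j, hj, hyj⟩
    obtain ⟨g, hga, hg, hgb⟩ := exists_flow hB (above v a) (ha.trans_le haa') ha'q.le hb'.nonneg
      hj hyj hb'.le_price
    obtain ⟨y, hyq, hy⟩ := jump (g q) (hgb q ⟨ha'q.le, le_rfl⟩)
    refine ⟨_, ?_, hy.extend ha'q (fun p hp => hG p ⟨haa'.trans hp.1, hp.2⟩) hg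
      (fun p hp => hgb p ⟨hp.1, hp.2.le⟩) hyq⟩
    simp [ha'q, hga]
  by_cases hj : ∃ j ∈ above v a, y₀ ≤ B j
  · exact low a y₀ le_rfl haq hbal hj
  push Not at hj
  -- The cap is above all remaining budgets, so nothing has been sold. It then falls linearly, until
  -- it meets the largest budget or the next exit price comes first.
  have hW : demand B (above v a) y₀ - y₀ = a := by
    rcases hbal.cases with h | h | ⟨j, hj', h⟩
    · exact h
    · linarith
    · have := hj j hj'; linarith
  rw [demand_eq_sum fun j hj' => (hj j hj').le] at hW
  obtain ⟨k, hk, hkmax⟩ := Finset.exists_max_image (above v a) B hne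
  set c := ∑ j ∈ above v a, B j with hc
  have hyk := hj k hk
  -- the price at which the cap reaches the largest budget
  set a' := c - B k with ha'
  have hlin : ∀ p ≤ a', ∀ j ∈ above v a, B j ≤ c - p := fun p hp j hj' => by
    have := hkmax j hj'; linarith
  have hlb : ∀ p, 0 ≤ p → p ≤ a' → Balanced B (above v a) p (c - p) := fun p hp0 hp => by
    refine ⟨?_, ?_, Or.inl ?_⟩
    · have := hlin p hp k hk; have := hB k; linarith
    all_goals rw [demand_eq_sum (hlin p hp)]; linarith
  rcases lt_or_ge a' q with h | h
  · obtain ⟨y, hya, hy⟩ := low a' (c - a') (by linarith) h (hlb a' (by linarith) le_rfl)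
      ⟨k, hk, by linarith⟩
    have he : atVal v a' = ∅ := by
      ext j
      simp only [mem_atVal, Finset.notMem_empty, iff_false]
      intro hj'
      have h1 : j ∈ above v a := by rw [mem_above, hj']; linarith
      rw [← hG a' ⟨by linarith, h⟩] at h1
      simp [hj'] at h1
    refine ⟨_, ?_, hy.extend (a := a) (g := fun p => c - p) (by linarith)
      (fun p hp => hG p ⟨hp.1, hp.2.trans h⟩)
      (rightFlow_linear ha (fun j hj' p hp => hlin p hp.2.le j hj') hc.symm)
      (fun p hp => hlb p (ha.le.trans hp.1) hp.2.le) ?_⟩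
    · rw [if_pos (by linarith)]; linarith
    · rw [hya, he, demand, Finset.sum_empty, sub_zero, max_eq_right]
      have := hB k; linarith
  · obtain ⟨y, hyq, hy⟩ := jump (c - q) (hlb q (by linarith) h)
    refine ⟨_, ?_, hy.extend (a := a) (g := fun p => c - p) haq hG
      (rightFlow_linear ha (fun j hj' p hp => hlin p (hp.2.le.trans h) j hj') hc.symm)
      (fun p hp => hlb p (ha.le.trans hp.1) (hp.2.le.trans h)) hyq⟩
    rw [if_pos haq]; linarith

end extend

/-- The cap on the effective budgets in the clinching auction as a function of the unit price. -/
structure IsPath (v B : ι → ℝ) (y : ℝ → ℝ) : Prop where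
  init : ∃ a > 0, (∀ p ∈ Icc 0 a, y p = ∑ j, B j - p) ∧ (∀ j, a < v j) ∧
    ∀ j, B j + a ≤ ∑ j, B j
  path : ∀ a, 0 < a → IsPathFrom v B a y

variable {v B : ι → ℝ} {y : ℝ → ℝ}

/-- The equation is singular at price `0`. Up to half the smallest of all valuations and budgets
nobody exits, and a second bidder keeps `∑ B - p` above each single budget, so the path is linear
there and the general construction takes over at a positive price. -/
theorem exists_isPath [Nontrivial ι] (hv : ∀ j, 0 < v j) (hB : ∀ j, 0 < B j) :
    ∃ y, IsPath v B y := by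
  classical
  obtain ⟨k, -, hk⟩ := Finset.exists_min_image Finset.univ (fun j => min (v j) (B j))
    Finset.univ_nonempty
  set m := min (v k) (B k) with hm
  have hm0 : 0 < m := lt_min (hv k) (hB k)
  have ha : 0 < m / 2 := by linarith
  have hmv : ∀ j, m / 2 < v j := fun j => by
    have := (hk j (Finset.mem_univ j)).trans (min_le_left _ _); linarith
  have hmB : ∀ j, m / 2 < B j := fun j => by
    have := (hk j (Finset.mem_univ j)).trans (min_le_right _ _); linarith
  have hsum : ∀ j, B j + m / 2 ≤ ∑ j, B j := fun j => by
    obtain ⟨i, hi⟩ := exists_ne j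
    have := Finset.add_le_sum (f := B) (fun l _ => (hB l).le) (Finset.mem_univ j)
      (Finset.mem_univ i) hi.symm
    have := hmB i
    linarith
  have hab : ∀ p, p ≤ m / 2 → above v p = Finset.univ := fun p hp => by
    ext j; simpa using hp.trans_lt (hmv j)
  have hbal : ∀ p, 0 ≤ p → p ≤ m / 2 → Balanced B Finset.univ p (∑ j, B j - p) := fun p hp0 hp => by
    have e : demand B Finset.univ (∑ j, B j - p) = ∑ j, B j :=
      demand_eq_sum fun j _ => by have := hsum j; linarith
    refine ⟨?_, by linarith, Or.inl (by linarith)⟩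
    have := hsum k; have := hB k; linarith
  obtain ⟨y, hya, hy⟩ := exists_isPathFrom (v := v) hB _ (m / 2) (∑ j, B j - m / 2) ha le_rfl
    (by rw [hab _ le_rfl]; exact hbal _ ha.le le_rfl)
  refine ⟨fun p => if p < m / 2 then ∑ j, B j - p else y p,
    ⟨m / 2, ha, fun p hp => ?_, hmv, hsum⟩, fun a ha0 => ?_⟩
  · rcases hp.2.lt_or_eq with h | rfl
    · simp [h]
    · simp [hya]
  · have key : ∀ a, 0 < a → a < m / 2 →
        IsPathFrom v B a fun p => if p < m / 2 then ∑ j, B j - p else y p := by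
      intro a ha0 h
      refine hy.extend (g := fun p => ∑ j, B j - p) h (fun p hp => hab p hp.2.le)
        (rightFlow_linear ha0 (fun j _ p hp => ?_) rfl)
        (fun p hp => hbal p (ha0.le.trans hp.1) hp.2.le) ?_
      · have := hsum j; have := hp.2; linarith
      · have e : atVal v (m / 2) = ∅ := by
          ext j; simpa using (hmv j).ne'
        rw [hya, e, demand, Finset.sum_empty, sub_zero, max_eq_right (hbal _ ha.le le_rfl).nonneg]
    have h2 := key (min a (m / 4)) (lt_min ha0 (by linarith))
      ((min_le_right _ _).trans_lt (by linarith))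
    exact ⟨fun p hp => h2.deriv p ((min_le_left _ _).trans hp),
      fun q hq => h2.jump q ((min_le_left _ _).trans_lt hq),
      fun p hp => h2.balanced p ((min_le_left _ _).trans hp)⟩

/-! ### Monotonicity of paths and comparison between different reports of one bidder. -/

section properties

theorem IsPath.balanced (h : IsPath v B y) {p : ℝ} (hp : 0 < p) : Balanced B (above v p) p (y p) :=
  (h.path p hp).balanced p le_rfl

theorem IsPath.deriv (h : IsPath v B y) {p : ℝ} (hp : 0 < p) :
    HasDerivWithinAt y (-((demand B (above v p) (y p) - y p) / p)) (Ici p) p :=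
  (h.path p hp).deriv p le_rfl

theorem IsPath.jump (h : IsPath v B y) {q : ℝ} (hq : 0 < q) :
    ∃ l, Tendsto y (𝓝[<] q) (𝓝 l) ∧ y q = max 0 (l - demand B (atVal v q) l) :=
  (h.path (q / 2) (by linarith)).jump q (by linarith)

theorem nonneg_of_tendsto_nhdsLT {y : ℝ → ℝ} {q l : ℝ} (hq : 0 < q) (hl : Tendsto y (𝓝[<] q) (𝓝 l))
    (hy : ∀ p, 0 < p → 0 ≤ y p) : 0 ≤ l := by
  refine ge_of_tendsto hl ?_
  filter_upwards [Ioo_mem_nhdsLT hq] with z hz using hy z hz.1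

theorem IsPath.antitoneOn (h : IsPath v B y) (hB : ∀ j, 0 < B j) : AntitoneOn y (Ioi 0) := by
  intro a ha b hb hab
  rw [mem_Ioi] at ha hb
  have := nonpos_of_rightDeriv (a := a) (b := b) (g := fun p => y p - y a)
    (g' := fun p => -((demand B (above v p) (y p) - y p) / p)) (by simp)
    (fun p hp => (h.deriv (ha.trans_le hp.1)).sub_const _)
    (fun p hp _ => neg_nonpos.2 (div_nonneg
      ((h.balanced (ha.trans_le hp.1)).supply_nonneg hB (ha.le.trans hp.1)) (ha.le.trans hp.1)))
    (fun q hq => ?_) b ⟨hab, le_rfl⟩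
  · linarith
  · obtain ⟨l, hl, he⟩ := h.jump (ha.trans hq.1)
    refine ⟨l - y a, hl.sub_const _, ?_⟩
    have hl0 : 0 ≤ l := nonneg_of_tendsto_nhdsLT (ha.trans hq.1) hl
      fun p hp => (h.balanced hp).nonneg
    have hya := (h.balanced ha).nonneg
    have hd : 0 ≤ demand B (atVal v q) l := demand_nonneg hB hl0
    rw [he]
    rcases max_cases 0 (l - demand B (atVal v q) l) with h1 | h1
    · rw [h1.1]; exact le_max_of_le_left (by linarith)
    · rw [h1.1]; exact le_max_of_le_right (by linarith)

/-- Comparing two paths that differ only in the valuation and the budget of one bidder: before that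
bidder exits, the caps differ by at most the difference of the budgets. -/
theorem IsPath.le_add {v' B' : ι → ℝ} {y' : ℝ → ℝ} {i : ι} (h : IsPath v B y)
    (h' : IsPath v' B' y') (hB : ∀ j, 0 < B j)
    (hnv : ∀ j, j ≠ i → v' j = v j) (hnB : ∀ j, j ≠ i → B' j = B j) (hle : B' i ≤ B i)
    {p : ℝ} (hp : 0 < p) (hpv : p < v i) (hpv' : p < v' i) : y p ≤ y' p + (B i - B' i) := by
  classical
  -- The comparison starts at a small price where both paths are linear and differ by exactly `B i -
  -- B' i`.
  obtain ⟨a, ha0, ha, -, -⟩ := h.init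
  obtain ⟨a', ha0', ha', -, -⟩ := h'.init
  set a₀ := min p (min a a') with ha₀
  have ha₀0 : 0 < a₀ := lt_min hp (lt_min ha0 ha0')
  have hsum : ∑ j, B j = ∑ j, B' j + (B i - B' i) := by
    rw [← Finset.sum_erase_add _ _ (Finset.mem_univ i),
      ← Finset.sum_erase_add _ B' (Finset.mem_univ i),
      Finset.sum_congr rfl fun j hj => hnB j (Finset.ne_of_mem_erase hj)]
    ring
  have hab : ∀ z, z ≤ p → above v' z = above v z := fun z hz => by
    ext j
    by_cases hj : j = i
    · subst hj; simp [hz.trans_lt hpv, hz.trans_lt hpv']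
    · simp [hnv j hj]
  have := nonpos_of_rightDeriv (a := a₀) (b := p) (g := fun z => y z - (y' z + (B i - B' i)))
    (g' := fun z => -((demand B (above v z) (y z) - y z) / z) -
      -((demand B' (above v' z) (y' z) - y' z) / z)) ?_
    (fun z hz => (h.deriv (ha₀0.trans_le hz.1)).sub
      ((h'.deriv (ha₀0.trans_le hz.1)).add_const _)) ?_ ?_ p ⟨min_le_left _ _, le_rfl⟩
  · linarith
  · have h1 := ha a₀ ⟨ha₀0.le, (min_le_right _ _).trans (min_le_left _ _)⟩
    have h2 := ha' a₀ ⟨ha₀0.le, (min_le_right _ _).trans (min_le_right _ _)⟩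
    linarith
  -- Where the claim fails, `y` exceeds `y'`, so by `Balanced.supply_mono` more is unsold along `y`,
  -- and `y` falls at least as fast.
  · intro z hz hgz
    have hz0 := ha₀0.trans_le hz.1
    rw [hab z hz.2.le]
    have hbb := h'.balanced hz0
    rw [hab z hz.2.le] at hbb
    have := (h.balanced hz0).supply_mono hB (i := i) (by simpa using hz.2.trans hpv) hnB hle hbb
      (by linarith)
    have : (demand B' (above v z) (y' z) - y' z) / z ≤ (demand B (above v z) (y z) - y z) / z := by
      gcongr
    linarith
  · intro q hq
    have hq0 := ha₀0.trans hq.1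
    obtain ⟨l, hl, he⟩ := h.jump hq0
    obtain ⟨l', hl', he'⟩ := h'.jump hq0
    refine ⟨l - (l' + (B i - B' i)), hl.sub (hl'.add_const _), ?_⟩
    have hl0 : 0 ≤ l := nonneg_of_tendsto_nhdsLT hq0 hl fun p hp => (h.balanced hp).nonneg
    have hy' := (h'.balanced hq0).nonneg
    rw [he]
    rcases max_cases 0 (l - demand B (atVal v q) l) with h1 | h1
    · rw [h1.1]; exact le_max_of_le_left (by linarith)
    · rw [h1.1]
      refine le_max_of_le_right ?_
      -- If `y` stays positive, it loses the exiting budgets in full, whereas `y'` loses at most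
      -- these budgets: bidder `i` is not among the exiting ones.
      have hE : ∀ j ∈ atVal v q, B j ≤ l := by
        intro j hj
        by_contra hc
        have := min_le_demand hB hl0 hj
        rw [min_eq_right (not_le.1 hc).le] at this
        linarith
      have hat : atVal v' q = atVal v q := by
        ext j
        by_cases hj : j = i
        · subst hj; simp [(hq.2.trans_lt hpv).ne', (hq.2.trans_lt hpv').ne']
        · simp [hnv j hj]
      have h2 : demand B' (atVal v' q) l' ≤ demand B (atVal v q) l := by
        rw [demand_eq_sum hE, hat]
        refine Finset.sum_le_sum fun j hj => ?_
        have hji : j ≠ i := by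
          rintro rfl
          rw [mem_atVal] at hj
          linarith [hq.2]
        rw [hnB j hji]; exact min_le_left _ _
      have h3 := le_max_right 0 (l' - demand B' (atVal v' q) l')
      linarith

/-- The comparison with equal budgets works in both directions. This is what allows true and false
valuations to be judged on a single path. -/
theorem IsPath.eq_of_lt {v' : ι → ℝ} {y' : ℝ → ℝ} {i : ι} (h : IsPath v B y)
    (h' : IsPath v' B y') (hB : ∀ j, 0 < B j) (hnv : ∀ j, j ≠ i → v' j = v j)
    {p : ℝ} (hp : 0 < p) (hpv : p < v i) (hpv' : p < v' i) : y p = y' p := by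
  have h1 := h.le_add h' hB hnv (fun _ _ => rfl) le_rfl hp hpv hpv'
  have h2 := h'.le_add h hB (fun j hj => (hnv j hj).symm) (fun _ _ => rfl) le_rfl hp hpv' hpv
  linarith

end properties

end

/-! ### Spending and surplus: incentives along one path. -/

section
/-- `π p` is the money extracted from a bidder with budget `c` up to the unit price `p`. -/
structure IsSpending (π : ℝ → ℝ) (c : ℝ) : Prop where
  nonneg : ∀ p, 0 < p → 0 ≤ π p
  le : ∀ p, 0 < p → π p ≤ c
  mono : MonotoneOn π (Ioi 0)
  zero : ∃ a > 0, ∀ p, 0 < p → p ≤ a → π p = 0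

/-- The value per unit of money of the purchases up to price `p`, net of payments. -/
noncomputable def surplus (π : ℝ → ℝ) (p : ℝ) : ℝ := ∫ q in (0 : ℝ)..p, π q / q ^ 2

section spending
variable {π π' : ℝ → ℝ} {c : ℝ}

/-- The integrand vanishes near `0`, which removes the singularity of `1 / q ^ 2`; measurability
comes from monotonicity. -/
theorem IsSpending.intervalIntegrable_zero (h : IsSpending π c) {b : ℝ} (hb : 0 ≤ b) :
    IntervalIntegrable (fun q => π q / q ^ 2) volume 0 b := by
  obtain ⟨a, ha, haz⟩ := h.zero
  rw [intervalIntegrable_iff_integrableOn_Ioc_of_le hb]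
  have hm : AEMeasurable π (volume.restrict (Ioc 0 b)) :=
    aemeasurable_restrict_of_monotoneOn measurableSet_Ioc (h.mono.mono fun _ hx => hx.1)
  refine Integrable.of_bound
    (hm.div (measurable_id.pow_const 2).aemeasurable).aestronglyMeasurable (c / a ^ 2) ?_
  filter_upwards [ae_restrict_mem measurableSet_Ioc] with q hq
  have hc : 0 ≤ c := (h.nonneg q hq.1).trans (h.le q hq.1)
  rcases le_or_gt q a with hqa | hqa
  · rw [haz q hq.1 hqa]; simp; positivity
  · rw [Real.norm_eq_abs, abs_of_nonneg (div_nonneg (h.nonneg q hq.1) (by positivity))]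
    exact div_le_div₀ hc (h.le q hq.1) (by positivity) (by gcongr)

theorem IsSpending.intervalIntegrable (h : IsSpending π c) {a b : ℝ} (ha : 0 ≤ a) (hb : 0 ≤ b) :
    IntervalIntegrable (fun q => π q / q ^ 2) volume a b :=
  (h.intervalIntegrable_zero ha).symm.trans (h.intervalIntegrable_zero hb)

theorem IsSpending.surplus_sub (h : IsSpending π c) {a b : ℝ} (ha : 0 ≤ a) (hb : 0 ≤ b) :
    surplus π b - surplus π a = ∫ q in a..b, π q / q ^ 2 :=
  intervalIntegral.integral_interval_sub_left (h.intervalIntegrable_zero hb)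
    (h.intervalIntegrable_zero ha)

/-- The endpoint `p` is excluded because paths for different reports may differ by a jump at the
reported valuation. -/
theorem surplus_congr {p : ℝ} (hp : 0 ≤ p) (h : ∀ q, 0 < q → q < p → π q = π' q) :
    surplus π p = surplus π' p := by
  unfold surplus
  rw [intervalIntegral.integral_of_le hp, intervalIntegral.integral_of_le hp,
    integral_Ioc_eq_integral_Ioo, integral_Ioc_eq_integral_Ioo]
  exact setIntegral_congr_fun measurableSet_Ioo fun q hq => by simp only [h q hq.1 hq.2]

theorem surplus_eq_zero {p : ℝ} (hp : 0 ≤ p) (h : ∀ q, 0 < q → q < p → π q = 0) :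
    surplus π p = 0 := by
  rw [surplus_congr (π' := fun _ => 0) hp h]; simp [surplus]

theorem IsSpending.surplus_nonneg (h : IsSpending π c) {p : ℝ} (hp : 0 ≤ p) : 0 ≤ surplus π p := by
  have := intervalIntegral.integral_mono_on_of_le_Ioo hp (f := fun _ => (0 : ℝ)) (by simp)
    (h.intervalIntegrable_zero hp)
    fun q hq => div_nonneg (h.nonneg q hq.1) (by positivity)
  simpa [surplus] using this

theorem surplus_mono {c' : ℝ} (h : IsSpending π c) (h' : IsSpending π' c') {p : ℝ} (hp : 0 ≤ p)
    (hle : ∀ q, 0 < q → q < p → π q ≤ π' q) : surplus π p ≤ surplus π' p :=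
  intervalIntegral.integral_mono_on_of_le_Ioo hp (h.intervalIntegrable_zero hp)
    (h'.intervalIntegrable_zero hp) fun q hq => by gcongr; exact hle q hq.1 hq.2

theorem integral_const_div_sq (P : ℝ) {a b : ℝ} (ha : 0 < a) (hab : a ≤ b) :
    IntervalIntegrable (fun q : ℝ => P / q ^ 2) volume a b ∧
      ∫ q in a..b, P / q ^ 2 = P * (1 / a - 1 / b) := by
  have hc : ContinuousOn (fun q : ℝ => P / q ^ 2) (uIcc a b) := by
    rw [uIcc_of_le hab]
    exact continuousOn_const.div (by fun_prop) fun q hq => (pow_pos (ha.trans_le hq.1) 2).ne'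
  refine ⟨hc.intervalIntegrable, ?_⟩
  rw [intervalIntegral.integral_eq_sub_of_hasDerivAt (f := fun q => -(P * q⁻¹))
    (fun q hq => ?_) hc.intervalIntegrable]
  · rw [one_div, one_div]; ring
  · rw [uIcc_of_le hab] at hq
    have := ((hasDerivAt_inv (ha.trans_le hq.1).ne').const_mul P).neg
    exact this.congr_deriv (by ring)

/-- Buying, at the price `w`, any part of what is bought there, is best for the valuation `w`. -/
theorem IsSpending.add_le_surplus (h : IsSpending π c) {w u P : ℝ} (hw : 0 < w) (hu : 0 < u)
    (h1 : ∀ q, 0 < q → q < w → π q ≤ P) (h2 : P ≤ π w) :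
    surplus π w + P * (1 / w - 1 / u) ≤ surplus π u := by
  -- The term `P * (1 / w - 1 / u)` is the integral of `P / q ^ 2` from `w` to `u`. Spending is at
  -- least `P` above `w` and at most `P` below it, so the inequality has the right sign in either
  -- order.
  rcases le_total w u with hwu | hwu
  · have e := h.surplus_sub hw.le hu.le
    obtain ⟨i1, i2⟩ := integral_const_div_sq P hw hwu
    have := intervalIntegral.integral_mono_on_of_le_Ioo hwu i1 (h.intervalIntegrable hw.le hu.le)
      fun q hq => by
        have := h.mono (mem_Ioi.2 hw) (mem_Ioi.2 (hw.trans hq.1)) hq.1.le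
        gcongr; exact h2.trans this
    linarith
  · have e := h.surplus_sub hu.le hw.le
    obtain ⟨i1, i2⟩ := integral_const_div_sq P hu hwu
    have := intervalIntegral.integral_mono_on_of_le_Ioo hwu (h.intervalIntegrable hu.le hw.le) i1
      fun q hq => by
        gcongr; exact h1 q (hu.trans hq.1) hq.2
    linarith

theorem IsSpending.continuousOn_surplus (h : IsSpending π c) {a b : ℝ} (ha : 0 ≤ a) (hab : a ≤ b) :
    ContinuousOn (surplus π) (Icc a b) := by
  have := intervalIntegral.continuousOn_primitive_interval (μ := volume)
    (f := fun q => π q / q ^ 2) (a := 0) (b := b) (by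
      rw [uIcc_of_le (ha.trans hab), integrableOn_Icc_iff_integrableOn_Ioc]
      exact (intervalIntegrable_iff_integrableOn_Ioc_of_le (ha.trans hab)).1
        (h.intervalIntegrable_zero (ha.trans hab)))
  rw [uIcc_of_le (ha.trans hab)] at this
  exact this.mono (Icc_subset_Icc_left ha)

theorem IsSpending.hasDerivWithinAt_surplus (h : IsSpending π c) {p : ℝ} (hp : 0 < p)
    (hc : ContinuousWithinAt π (Ici p) p) :
    HasDerivWithinAt (surplus π) (π p / p ^ 2) (Ici p) p := by
  refine intervalIntegral.integral_hasDerivWithinAt_right (h.intervalIntegrable_zero hp.le)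
    (t := Ioi p) ?_ ?_
  · refine ⟨Ioc p (p + 1), Ioc_mem_nhdsGT (by linarith), ?_⟩
    exact ((h.intervalIntegrable hp.le (by linarith : (0 : ℝ) ≤ p + 1)).1).aestronglyMeasurable
  · exact (hc.mono Ioi_subset_Ici_self).div (by fun_prop) (by positivity)

end spending

variable {ι : Type*} [Fintype ι] {v B : ι → ℝ} {y : ℝ → ℝ}

/-- What is missing of the budget `c` when budgets are capped at `y`. -/
noncomputable def spent (c : ℝ) (y : ℝ → ℝ) (p : ℝ) : ℝ := c - min c (y p)

theorem IsPath.isSpending (h : IsPath v B y) (hB : ∀ j, 0 < B j) (i : ι) :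
    IsSpending (spent (B i) y) (B i) := by
  refine ⟨fun p _ => ?_, fun p hp => ?_, fun p hp q hq hpq => ?_, ?_⟩
  · have := min_le_left (B i) (y p); unfold spent; linarith
  · have := le_min (hB i).le (h.balanced hp).nonneg; unfold spent; linarith
  · have := min_le_min_left (B i) (h.antitoneOn hB hp hq hpq); unfold spent; linarith
  · obtain ⟨a, ha, hy, -, hs⟩ := h.init
    refine ⟨a, ha, fun p hp hpa => ?_⟩
    rw [spent, hy p ⟨hp.le, hpa⟩, min_eq_left (by have := hs i; linarith), sub_self]

/-- A larger budget lets a bidder spend more at every price. -/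
theorem spent_mono {v' B' : ι → ℝ} {y' : ℝ → ℝ} {i : ι} (h : IsPath v B y)
    (h' : IsPath v' B' y') (hB : ∀ j, 0 < B j)
    (hnv : ∀ j, j ≠ i → v' j = v j) (hnB : ∀ j, j ≠ i → B' j = B j) (hle : B' i ≤ B i)
    {p : ℝ} (hp : 0 < p) (hpv : p < v i) (hpv' : p < v' i) :
    spent (B' i) y' p ≤ spent (B i) y p := by
  have := h.le_add h' hB hnv hnB hle hp hpv hpv'
  unfold spent
  rcases min_cases (B' i) (y' p) with h1 | h1
  · have := min_le_left (B i) (y p); linarith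
  · have := min_le_right (B i) (y p); linarith

end

/-! ### Runs of the auction, and states described by a cap. -/

section
theorem RightFlow.shift {g r : ℝ → ℝ} {a b : ℝ} (h : RightFlow g r a b) (d : ℝ) :
    RightFlow (fun t => g (t + d)) (fun t => r (t + d)) (a - d) (b - d) := by
  constructor
  · refine h.cont.comp (by fun_prop) fun t ht => ?_
    exact ⟨by linarith [ht.1], by linarith [ht.2]⟩
  · intro t ht
    have h1 := h.deriv (t + d) ⟨by linarith [ht.1], by linarith [ht.2]⟩
    have h2 : HasDerivWithinAt (fun t => t + d) 1 (Ici t) t :=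
      ((hasDerivAt_id t).add_const d).hasDerivWithinAt
    have := h1.scomp t h2 (fun z hz => by simpa using hz)
    rw [one_smul] at this
    exact this

variable {n : ℕ} {v B : Fin n → ℝ}

/-- The clinching auction evolves from `s a` to `s b` without stopping before `b`. -/
structure ClinchingOn (v : Fin n → ℝ) (s : ℝ → State n) (a b : ℝ) : Prop where
  price : RightFlow (fun t => (s t).price) (fun t => (s t).priceRate v) a b
  alloc : ∀ i, RightFlow (fun t => (s t).alloc i) (fun t => (s t).allocRate v i) a b
  paid : ∀ i, RightFlow (fun t => (s t).paid i) (fun t => (s t).paidRate v i) a b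
  budget : ∀ i, RightFlow (fun t => (s t).budget i) (fun t => (s t).budgetRate v i) a b
  not_stops : ∀ t ∈ Ico a b, ¬ (s t).Stops v

theorem ClinchingOn.shift {s : ℝ → State n} {a b : ℝ} (h : ClinchingOn v s a b) (d : ℝ) :
    ClinchingOn v (fun t => s (t + d)) (a - d) (b - d) :=
  ⟨h.price.shift d, fun i => (h.alloc i).shift d, fun i => (h.paid i).shift d,
    fun i => (h.budget i).shift d,
    fun t ht => h.not_stops (t + d) ⟨by linarith [ht.1], by linarith [ht.2]⟩⟩

theorem RightFlow.glue_comp {α : Type*} {s₁ s₂ : ℝ → α} {G R : α → ℝ} {a b c : ℝ} (hab : a ≤ b)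
    (hbc : b ≤ c) (h₁ : RightFlow (fun t => G (s₁ t)) (fun t => R (s₁ t)) a b)
    (h₂ : RightFlow (fun t => G (s₂ t)) (fun t => R (s₂ t)) b c) (he : s₁ b = s₂ b) :
    RightFlow (fun t => G (if t < b then s₁ t else s₂ t))
      (fun t => R (if t < b then s₁ t else s₂ t)) a c :=
  (h₁.glue hab hbc h₂ (by rw [he])).congr (fun t _ => by split_ifs <;> rfl)
    (fun t _ => by split_ifs <;> rfl)

theorem ClinchingOn.glue {s₁ s₂ : ℝ → State n} {a b c : ℝ} (hab : a ≤ b) (hbc : b ≤ c)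
    (h₁ : ClinchingOn v s₁ a b) (h₂ : ClinchingOn v s₂ b c) (he : s₁ b = s₂ b) :
    ClinchingOn v (fun t => if t < b then s₁ t else s₂ t) a c := by
  refine ⟨RightFlow.glue_comp hab hbc h₁.price h₂.price he,
    fun i => RightFlow.glue_comp (G := fun s => s.alloc i) (R := fun s => s.allocRate v i)
      hab hbc (h₁.alloc i) (h₂.alloc i) he,
    fun i => RightFlow.glue_comp (G := fun s => s.paid i) (R := fun s => s.paidRate v i)
      hab hbc (h₁.paid i) (h₂.paid i) he,
    fun i => RightFlow.glue_comp (G := fun s => s.budget i) (R := fun s => s.budgetRate v i)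
      hab hbc (h₁.budget i) (h₂.budget i) he, fun t ht => ?_⟩
  by_cases htb : t < b
  · simpa [htb] using h₁.not_stops t ⟨ht.1, htb⟩
  · simpa [htb] using h₂.not_stops t ⟨not_lt.1 htb, ht.2⟩

/-- The clinching auction leads from the state `s₀` to the state `s₁`. -/
def Leads (v : Fin n → ℝ) (s₀ s₁ : State n) : Prop :=
  ∃ (s : ℝ → State n) (b : ℝ), 0 ≤ b ∧ ClinchingOn v s 0 b ∧ s 0 = s₀ ∧ s b = s₁

theorem Leads.refl (s₀ : State n) : Leads v s₀ s₀ :=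
  ⟨fun _ => s₀, 0, le_rfl, ⟨rightFlow_refl _ _ _, fun _ => rightFlow_refl _ _ _,
    fun _ => rightFlow_refl _ _ _, fun _ => rightFlow_refl _ _ _, by simp⟩, rfl, rfl⟩

theorem ClinchingOn.leads {s : ℝ → State n} {a b : ℝ} (hab : a ≤ b) (h : ClinchingOn v s a b) :
    Leads v (s a) (s b) := by
  refine ⟨fun t => s (t + a), b - a, by linarith, ?_, by simp, by simp⟩
  simpa using h.shift a

theorem Leads.trans {s₀ s₁ s₂ : State n} (h₁ : Leads v s₀ s₁) (h₂ : Leads v s₁ s₂) :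
    Leads v s₀ s₂ := by
  obtain ⟨s, b, hb, hs, h0, hsb⟩ := h₁
  obtain ⟨s', b', hb', hs', h0', hsb'⟩ := h₂
  have hs2 := hs'.shift (-b)
  simp only [sub_neg_eq_add, zero_add] at hs2
  have hg := hs.glue hb (by linarith : b ≤ b' + b) hs2 (by simp [hsb, h0'])
  have := hg.leads (by linarith)
  -- For `b = 0` the glued function takes its initial value from the second run.
  rcases hb.eq_or_lt with rfl | hb0
  · simpa [h0', hsb', ← h0, hsb, not_lt.2 hb'] using this
  · simpa [hb0, h0, hsb', not_lt.2 hb'] using this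

/-- A state of the clinching auction in which the budgets of the active bidders are capped at `c`,
the exiting bidders have the budgets `r`, and all others have no budget left. -/
structure IsCapped (v B : Fin n → ℝ) (s : State n) (c : ℝ) (r : Fin n → ℝ) : Prop where
  budget : ∀ i, s.budget i = if s.price < v i then min (B i) c else r i
  zero : ∀ i, v i ≠ s.price → r i = 0
  nonneg : ∀ i, 0 ≤ r i
  lt : ∑ i, r i < c
  supply : s.price * s.supply = demand B (above v s.price) c + ∑ i, r i - c

section capped
variable {s : State n} {c : ℝ} {r : Fin n → ℝ}

theorem IsCapped.pos (h : IsCapped v B s c r) : 0 < c :=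
  (Finset.sum_nonneg fun i _ => h.nonneg i).trans_lt h.lt

theorem IsCapped.active_eq (h : IsCapped v B s c r) (hB : ∀ j, 0 < B j) :
    s.active v = above v s.price := by
  ext i
  simp only [State.active, Finset.mem_filter, Finset.mem_univ, true_and, mem_above,
    and_iff_left_iff_imp]
  intro hi
  rw [h.budget, if_pos hi]
  exact lt_min (hB i) h.pos

/-- The active demand exceeds the value of the supply by `c - ∑ i, r i`, so the auction goes on as
long as the exiting budgets stay below the cap. -/
theorem IsCapped.not_stops (h : IsCapped v B s c r) (hB : ∀ j, 0 < B j) : ¬ s.Stops v := by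
  rw [State.Stops, h.active_eq hB, h.supply, not_le]
  have : ∑ i ∈ above v s.price, s.budget i = demand B (above v s.price) c :=
    Finset.sum_congr rfl fun i hi => by rw [h.budget, if_pos (mem_above.1 hi)]
  rw [this]
  linarith [h.lt]

theorem IsCapped.mem_exiting (h : IsCapped v B s c r) {i : Fin n} :
    i ∈ s.exiting v ↔ 0 < r i := by
  simp only [State.exiting, Finset.mem_filter, Finset.mem_univ, true_and]
  constructor
  · rintro ⟨h1, h2⟩
    rwa [h.budget, if_neg (by rw [h1]; exact lt_irrefl _)] at h2
  · intro hr
    have h1 : v i = s.price := by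
      by_contra h1
      rw [h.zero i h1] at hr; exact lt_irrefl _ hr
    exact ⟨h1, by rwa [h.budget, if_neg (by rw [h1]; exact lt_irrefl _)]⟩

/-- The total effective budget is the value of the supply plus `c`. Removing an active bidder
therefore gives equality exactly when her effective budget is `c`. -/
theorem IsCapped.mem_clinching (h : IsCapped v B s c r) (hB : ∀ j, 0 < B j) {i : Fin n} :
    i ∈ s.clinching v ↔ s.price < v i ∧ c ≤ B i := by
  rw [State.clinching, Finset.mem_filter, h.active_eq hB, mem_above]
  refine and_congr_right fun hi => ?_
  have htot : ∑ j, s.budget j = demand B (above v s.price) c + ∑ j, r j := by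
    rw [demand, above, Finset.sum_filter, ← Finset.sum_add_distrib]
    refine Finset.sum_congr rfl fun j _ => ?_
    rw [h.budget]
    split_ifs with hj
    · rw [h.zero j hj.ne', add_zero]
    · rw [zero_add]
  have he := Finset.sum_erase_add Finset.univ s.budget (Finset.mem_univ i)
  rw [htot, h.budget i, if_pos hi] at he
  rw [h.supply, ← min_eq_right_iff]
  constructor
  · intro h1; linarith
  · intro h1; linarith

end capped

/-- The state of the clinching auction at unit price `p` when the bidders in `G` are left, and their
budgets are capped at `c`, having followed the path `y` before. -/
noncomputable def capState (B : Fin n → ℝ) (y : ℝ → ℝ) (G : Finset (Fin n)) (p c : ℝ) :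
    State n where
  price := p
  alloc i := if i ∈ G then surplus (spent (B i) y) p + (B i - min (B i) c) / p else 0
  paid i := if i ∈ G then B i - min (B i) c else 0
  budget i := if i ∈ G then min (B i) c else 0

variable {y : ℝ → ℝ}

theorem capState_supply (G : Finset (Fin n)) (p c : ℝ) :
    (capState B y G p c).supply =
      1 - ∑ i ∈ G, (surplus (spent (B i) y) p + (B i - min (B i) c) / p) := by
  simp [State.supply, capState]

/-- The part of a path between two prices at which bidders exit. -/
theorem IsPath.rightFlow (h : IsPath v B y) {p q l : ℝ} (hp : 0 < p) (hpq : p < q)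
    (hG : ∀ z ∈ Ico p q, above v z = above v p) (hl : Tendsto y (𝓝[<] q) (𝓝 l)) :
    RightFlow (fun z => if z < q then y z else l)
      (fun z => -((demand B (above v p) (y z) - y z) / z)) p q := by
  have hE : ∀ z ∈ Ioo p q, atVal v z = ∅ := by
    intro z hz
    ext j
    simp only [mem_atVal, Finset.notMem_empty, iff_false]
    intro hj
    have h1 : j ∈ above v p := by simp [hj, hz.1]
    rw [← hG z ⟨hz.1.le, hz.2⟩] at h1
    simp [hj] at h1
  have hd : ∀ z ∈ Ico p q, HasDerivWithinAt (fun z => if z < q then y z else l)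
      (-((demand B (above v p) (y z) - y z) / z)) (Ici z) z := fun z hz => by
    have := h.deriv (hp.trans_le hz.1)
    rw [hG z hz] at this
    exact HasDerivWithinAt.congr_Ici this hz.2 fun u hu => by simp [hu.2]
  -- Inside the interval nobody exits, so the jump condition becomes left continuity; at `q` the
  -- left limit `l` stands in for `y q`.
  have hleft : ∀ z ∈ Ioc p q, ContinuousWithinAt (fun z => if z < q then y z else l) (Iio z) z := by
    intro z hz
    rcases hz.2.lt_or_eq with hzq | rfl
    · obtain ⟨l', hl', he⟩ := h.jump (hp.trans hz.1)
      have : y z = l' := by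
        rw [he, hE z ⟨hz.1, hzq⟩, demand, Finset.sum_empty, sub_zero, max_eq_right]
        exact nonneg_of_tendsto_nhdsLT (hp.trans hz.1) hl' fun p hp => (h.balanced hp).nonneg
      simp only [ContinuousWithinAt, hzq, if_true, this]
      exact tendsto_nhdsLT_congr hz.1 hl' fun u hu => by simp [hu.2.trans hzq]
    · simp only [ContinuousWithinAt, lt_irrefl, if_false]
      exact tendsto_nhdsLT_congr hz.1 hl fun u hu => by simp [hu.2]
  refine ⟨fun z hz => ?_, hd⟩
  rcases hz.1.eq_or_lt with rfl | hz1
  · exact (hd p ⟨le_rfl, hpq⟩).continuousWithinAt.mono Icc_subset_Ici_self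
  rcases hz.2.lt_or_eq with hz2 | rfl
  · have := (hleft z ⟨hz1, hz2.le⟩).union (hd z ⟨hz1.le, hz2⟩).continuousWithinAt
    exact this.mono fun u _ => by simp
  · have := continuousWithinAt_insert_self.2 (hleft z ⟨hz1, le_rfl⟩)
    rw [Iio_insert] at this
    exact this.mono Icc_subset_Iic_self

/-- The cap stays positive between the prices at which bidders exit. -/
theorem IsPath.pos_of_flow (h : IsPath v B y) {p q l : ℝ} (hp : 0 < p) (hpq : p < q)
    (hG : ∀ z ∈ Ico p q, above v z = above v p) (hl : Tendsto y (𝓝[<] q) (𝓝 l)) (hy : 0 < y p) :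
    (∀ z ∈ Ico p q, 0 < y z) ∧ 0 < l := by
  have hf := h.rightFlow hp hpq hG hl
  set Y : ℝ → ℝ := fun z => if z < q then y z else l with hY
  -- At most `n` bidders are left, so the demand is at most `n * y`; hence `y z * z ^ (n + 1)` does
  -- not decrease, and the cap decays no faster than a power of the price.
  have key := nonpos_of_rightDeriv (a := p) (b := q)
    (g := fun z => y p * p ^ (n + 1) - Y z * z ^ (n + 1))
    (g' := fun z => -(-((demand B (above v p) (y z) - y z) / z) * z ^ (n + 1) +
      Y z * ((n + 1 : ℕ) * z ^ n)))
    (by simp [hY, hpq])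
    (fun z hz => ((hf.deriv z hz).mul
      (by simpa using (hasDerivAt_pow (n + 1) z).hasDerivWithinAt)).const_sub _)
    (fun z hz _ => ?_)
    (fun z hz => ⟨_, tendsto_nhdsLT_of_continuousOn
      (continuousOn_const.sub (hf.cont.mul (by fun_prop))) hz, le_max_right _ _⟩)
  · have pos : ∀ z ∈ Icc p q, 0 < Y z := by
      intro z hz
      have h1 := key z hz
      have h2 : 0 < p ^ (n + 1) := pow_pos hp _
      have h3 : 0 < z ^ (n + 1) := pow_pos (hp.trans_le hz.1) _
      have h4 : 0 < Y z * z ^ (n + 1) := by nlinarith [mul_pos hy h2]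
      exact (pos_iff_pos_of_mul_pos h4).2 h3
    exact ⟨fun z hz => by simpa [hY, hz.2] using pos z ⟨hz.1, hz.2.le⟩,
      by simpa [hY] using pos q ⟨hpq.le, le_rfl⟩⟩
  · have hz0 : 0 < z := hp.trans_le hz.1
    have hyz : 0 ≤ y z := (h.balanced hz0).nonneg
    have h1 : demand B (above v p) (y z) ≤ n * y z := by
      refine demand_le_card.trans ?_
      have : (above v p).card ≤ n := by simpa using Finset.card_le_univ (above v p)
      gcongr
    have hYz : Y z = y z := by simp [hY, hz.2]
    rw [hYz]
    have e : -(-((demand B (above v p) (y z) - y z) / z) * z ^ (n + 1) +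
        y z * ((n + 1 : ℕ) * z ^ n)) =
        -(z ^ n * ((n * y z - demand B (above v p) (y z)) + 2 * y z)) := by
      push_cast; field_simp; ring
    rw [e]
    have : 0 ≤ (n * y z - demand B (above v p) (y z)) + 2 * y z := by linarith
    have := mul_nonneg (pow_pos hz0 n).le this
    linarith

end

/-! ### The two phases of a run: rising price and exiting bidders. -/

section
variable {n : ℕ} {v B : Fin n → ℝ} {y : ℝ → ℝ}

theorem rightFlow_const (k a b : ℝ) : RightFlow (fun _ => k) (fun _ => 0) a b :=
  ⟨continuousOn_const, fun t _ => hasDerivWithinAt_const t _ k⟩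

theorem RightFlow.min_const {g r : ℝ → ℝ} {a b : ℝ} (h : RightFlow g r a b)
    (hanti : AntitoneOn g (Icc a b)) (k : ℝ) :
    RightFlow (fun t => min k (g t)) (fun t => if g t ≤ k then r t else 0) a b := by
  refine ⟨continuousOn_const.inf h.cont, fun t ht => ?_⟩
  exact hasDerivWithinAt_min_const ht.2 (h.deriv t ht) fun z hz =>
    hanti ⟨ht.1, ht.2.le⟩ ⟨ht.1.trans hz.1, hz.2.le⟩ hz.1

/-- The supply in a rising phase, as a function of the cap. -/
theorem IsPath.supply_eq (h : IsPath v B y) (hB : ∀ j, 0 < B j) {p q : ℝ} (hp : 0 < p)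
    {G : Finset (Fin n)} {Y : ℝ → ℝ} (hY : ∀ z ∈ Ico p q, Y z = y z)
    (hf : RightFlow Y (fun z => -((demand B G (y z) - y z) / z)) p q)
    (hS : p * (capState B y G p (Y p)).supply = demand B G (Y p) - Y p) :
    ∀ z ∈ Icc p q, z * (capState B y G z (Y z)).supply = demand B G (Y z) - Y z := by
  -- The defect of the claimed identity is `z` times a function with vanishing right derivative, so
  -- it stays zero once it is zero at `p`.
  have e : ∀ z, 0 < z → z * (capState B y G z (Y z)).supply - (demand B G (Y z) - Y z) =
      z * (1 - ∑ i ∈ G, surplus (spent (B i) y) z - (∑ i ∈ G, B i - Y z) / z) := by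
    intro z hz
    rw [capState_supply, Finset.sum_add_distrib, ← Finset.sum_div, Finset.sum_sub_distrib, demand]
    field_simp
    ring
  have hc := constant_of_has_deriv_right_zero (a := p) (b := q)
    (f := fun z => 1 - ∑ i ∈ G, surplus (spent (B i) y) z - (∑ i ∈ G, B i - Y z) / z) ?_ ?_
  · intro z hz
    have hz0 := hp.trans_le hz.1
    have h1 := e p hp
    have h2 := e z hz0
    rw [hc z hz] at h2
    have h3 : p * (1 - ∑ i ∈ G, surplus (spent (B i) y) p - (∑ i ∈ G, B i - Y p) / p) = 0 := by
      rw [← h1]; linarith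
    rw [(mul_eq_zero.1 h3).resolve_left hp.ne', mul_zero] at h2
    linarith
  · by_cases hpq : p ≤ q
    · refine (continuousOn_const.sub (continuousOn_finsetSum _ fun i _ =>
        (h.isSpending hB i).continuousOn_surplus hp.le hpq)).sub
        ((continuousOn_const.sub hf.cont).div continuousOn_id fun z hz => (hp.trans_le hz.1).ne')
    · rw [Icc_eq_empty hpq]; exact continuousOn_empty _
  · intro z hz
    have hz0 := hp.trans_le hz.1
    have hcy : ContinuousWithinAt y (Ici z) z := (h.deriv hz0).continuousWithinAt
    have d1 := HasDerivWithinAt.fun_sum (u := G) (x := z) (s := Ici z)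
      (A := fun i => surplus (spent (B i) y))
      (A' := fun i => spent (B i) y z / z ^ 2) fun i _ =>
      (h.isSpending hB i).hasDerivWithinAt_surplus hz0
        (continuousWithinAt_const.sub (continuousWithinAt_const.inf hcy))
    have d2 := ((hf.deriv z hz).const_sub (∑ i ∈ G, B i)).div
      (hasDerivAt_id z).hasDerivWithinAt hz0.ne'
    refine ((d1.const_sub 1).sub d2).congr_deriv ?_
    have hs : ∑ i ∈ G, spent (B i) y z / z ^ 2 = (∑ i ∈ G, B i - demand B G (y z)) / z ^ 2 := by
      rw [← Finset.sum_div, demand, ← Finset.sum_sub_distrib]; rfl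
    rw [hs, hY z hz]
    simp only [id]
    field_simp
    ring

/-- The price rises until some bidders exit. -/
theorem IsPath.rising (h : IsPath v B y) (hB : ∀ j, 0 < B j) {p q l : ℝ} (hp : 0 < p) (hpq : p < q)
    (hG : ∀ z ∈ Ico p q, above v z = above v p) (hl : Tendsto y (𝓝[<] q) (𝓝 l)) (hy : 0 < y p)
    (hS : p * (capState B y (above v p) p (y p)).supply = demand B (above v p) (y p) - y p) :
    Leads v (capState B y (above v p) p (y p)) (capState B y (above v p) q l) ∧
      q * (capState B y (above v p) q l).supply = demand B (above v p) l - l := by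
  have hf := h.rightFlow hp hpq hG hl
  have hpos := (h.pos_of_flow hp hpq hG hl hy).1
  set Y : ℝ → ℝ := fun z => if z < q then y z else l with hY
  have hYy : ∀ z ∈ Ico p q, Y z = y z := fun z hz => by simp [hY, hz.2]
  have hYp : Y p = y p := hYy p ⟨le_rfl, hpq⟩
  have hYq : Y q = l := by simp [hY]
  set G := above v p with hGdef
  rw [← hYp, ← hYq]
  have hsup := h.supply_eq hB hp hYy hf (by rw [hYp]; exact hS)
  refine ⟨?_, hsup q ⟨hpq.le, le_rfl⟩⟩
  set s : ℝ → State n := fun z => capState B y G z (Y z) with hs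
  have hcap : ∀ z ∈ Ico p q, IsCapped v B (s z) (Y z) fun _ => 0 := by
    intro z hz
    have hab : above v (s z).price = G := hG z hz
    refine ⟨fun i => ?_, fun _ _ => rfl, fun _ => le_rfl, ?_, ?_⟩
    · have : i ∈ G ↔ (s z).price < v i := by rw [← hab, mem_above]
      simp only [← this]; rfl
    · rw [Finset.sum_const_zero, hYy z hz]; exact hpos z hz
    · rw [hab, Finset.sum_const_zero, add_zero]; exact hsup z ⟨hz.1, hz.2.le⟩
  have hex : ∀ z ∈ Ico p q, (s z).exiting v = ∅ := fun z hz => by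
    ext i
    rw [(hcap z hz).mem_exiting]; simp
  have hcl : ∀ z ∈ Ico p q, ∀ i, i ∈ (s z).clinching v ↔ i ∈ G ∧ Y z ≤ B i := fun z hz i => by
    rw [(hcap z hz).mem_clinching hB, ← hG z hz, mem_above]; rfl
  have hrate : ∀ z ∈ Ico p q, (s z).extractionRate v = (demand B G (y z) - y z) / z := fun z hz => by
    have hz0 := hp.trans_le hz.1
    rw [State.extractionRate, if_pos (hex z hz), eq_div_iff hz0.ne', mul_comm]
    have := hsup z ⟨hz.1, hz.2.le⟩
    rw [this, hYy z hz]
  have hanti : AntitoneOn Y (Icc p q) := by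
    have ha := h.antitoneOn hB
    intro a ha' b hb hab
    rcases hb.2.lt_or_eq with h1 | rfl
    · simp only [hY, h1, hab.trans_lt h1, if_true]
      exact ha (hp.trans_le ha'.1) (hp.trans_le hb.1) hab
    rcases hab.eq_or_lt with rfl | h2
    · exact le_rfl
    · simp only [hY, h2, if_true, lt_irrefl, if_false]
      refine le_of_tendsto hl ?_
      filter_upwards [Ioo_mem_nhdsLT h2] with z hz
      exact ha (hp.trans_le ha'.1) ((hp.trans_le ha'.1).trans hz.1) hz.1.le
  have hmin : ∀ i, RightFlow (fun z => min (B i) (Y z))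
      (fun z => if Y z ≤ B i then -((demand B G (y z) - y z) / z) else 0) p q :=
    fun i => hf.min_const hanti (B i)
  refine ClinchingOn.leads (s := s) hpq.le ⟨?_, fun i => ?_, fun i => ?_, fun i => ?_,
    fun t ht => (hcap t ht).not_stops hB⟩
  · refine ⟨continuousOn_id, fun t ht => ?_⟩
    rw [State.priceRate, if_pos (hex t ht)]
    exact (hasDerivAt_id t).hasDerivWithinAt
  · by_cases hi : i ∈ G
    · have e : ∀ z, (s z).alloc i =
          surplus (spent (B i) y) z + (B i - min (B i) (Y z)) / z := fun z => by
        simp [hs, capState, hi]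
      simp only [e]
      refine ⟨((h.isSpending hB i).continuousOn_surplus hp.le hpq.le).add
        ((continuousOn_const.sub (hmin i).cont).div continuousOn_id
          fun z hz => (hp.trans_le hz.1).ne'), fun z hz => ?_⟩
      have hz0 := hp.trans_le hz.1
      have hcy : ContinuousWithinAt y (Ici z) z := (h.deriv hz0).continuousWithinAt
      -- In the derivative of `surplus + π / z` the terms `π / z ^ 2` cancel and `π' / z` remains:
      -- increments are bought at the current price.
      refine (((h.isSpending hB i).hasDerivWithinAt_surplus hz0
        (continuousWithinAt_const.sub (continuousWithinAt_const.inf hcy))).add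
        (((hmin i).deriv z hz).const_sub (B i) |>.div
          (hasDerivAt_id z).hasDerivWithinAt hz0.ne')).congr_deriv ?_
      rw [State.allocRate, hrate z hz]
      have hpr : (s z).price = z := rfl
      simp only [hcl z hz, hi, true_and, hpr, spent, id, hYy z hz]
      split_ifs
      · field_simp; ring
      · field_simp; ring
    · refine (rightFlow_const 0 p q).congr (fun t _ => by simp [hs, capState, hi]) fun t ht => ?_
      rw [State.allocRate, if_neg (by rw [hcl t ht]; tauto)]
  · by_cases hi : i ∈ G
    · refine RightFlow.congr (g := fun z => B i - min (B i) (Y z)) (r := fun z =>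
        -(if Y z ≤ B i then -((demand B G (y z) - y z) / z) else 0))
        ⟨continuousOn_const.sub (hmin i).cont, fun z hz => ((hmin i).deriv z hz).const_sub _⟩
        (fun t _ => by simp [hs, capState, hi]) fun t ht => ?_
      rw [State.paidRate, hrate t ht]
      simp only [hcl t ht, hi, true_and]
      split_ifs <;> simp
    · refine (rightFlow_const 0 p q).congr (fun t _ => by simp [hs, capState, hi]) fun t ht => ?_
      rw [State.paidRate, if_neg (by rw [hcl t ht]; tauto)]
  · by_cases hi : i ∈ G
    · refine (hmin i).congr (fun t _ => by simp [hs, capState, hi]) fun t ht => ?_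
      rw [State.budgetRate, hrate t ht]
      simp only [hcl t ht, hi, true_and, hex t ht, Finset.notMem_empty, false_and, if_false]
    · refine (rightFlow_const 0 p q).congr (fun t _ => by simp [hs, capState, hi]) fun t ht => ?_
      rw [State.budgetRate, if_neg (by rw [hcl t ht]; tauto)]
      simp [hex t ht]

/-- One exiting bidder loses her effective budget, while the price rests. -/
theorem exit_one (hB : ∀ j, 0 < B j) {q c : ℝ} (hq : 0 < q) {E : Finset (Fin n)} {j : Fin n}
    (hE : E ⊆ atVal v q) (hj : j ∈ E) (hjmin : ∀ i ∈ E, j ≤ i)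
    (hc : ∑ i ∈ E, B i < c) (hφ : ∀ i ∈ E, surplus (spent (B i) y) q = 0)
    (hS : q * (capState B y (above v q ∪ E) q c).supply = demand B (above v q ∪ E) c - c) :
    Leads v (capState B y (above v q ∪ E) q c)
      (capState B y (above v q ∪ E.erase j) q (c - B j)) ∧
    q * (capState B y (above v q ∪ E.erase j) q (c - B j)).supply =
      demand B (above v q ∪ E.erase j) (c - B j) - (c - B j) := by
  have hEv : ∀ i ∈ E, v i = q := fun i hi => mem_atVal.1 (hE hi)
  have hsumE : ∑ i ∈ E.erase j, B i + B j = ∑ i ∈ E, B i := Finset.sum_erase_add _ _ hj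
  have hBle : ∀ i ∈ E, B i ≤ ∑ i ∈ E, B i := fun i hi =>
    Finset.single_le_sum (fun i _ => (hB i).le) hi
  have hBle' : ∀ i ∈ E.erase j, B i ≤ ∑ i ∈ E.erase j, B i := fun i hi =>
    Finset.single_le_sum (fun i _ => (hB i).le) hi
  have hdis : ∀ E' ⊆ E, Disjoint (above v q) E' := fun E' hE' =>
    (disjoint_above_atVal v q).mono_right (hE'.trans hE)
  -- the budgets of the exiting bidders
  set r : ℝ → Fin n → ℝ := fun t i => if i = j then B j - t else if i ∈ E then B i else 0 with hr
  -- While `j` loses budget at unit rate, the cap `c - t` falls at the same rate, and the exiting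
  -- bidders hold and have paid nothing.
  set s : ℝ → State n := fun t =>
    { price := q
      alloc := fun i => if q < v i then
        surplus (spent (B i) y) q + (B i - min (B i) (c - t)) / q else 0
      paid := fun i => if q < v i then B i - min (B i) (c - t) else 0
      budget := fun i => if q < v i then min (B i) (c - t) else r t i } with hs
  have hsr : ∀ t, ∑ i, r t i = ∑ i ∈ E, B i - t := by
    intro t
    rw [← Finset.sum_erase_add _ _ (Finset.mem_univ j), ← hsumE]
    have h1 : ∑ i ∈ Finset.univ.erase j, r t i = ∑ i ∈ E.erase j, B i := by
      rw [← Finset.sum_filter_add_sum_filter_not (Finset.univ.erase j) (· ∈ E)]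
      have e1 : (Finset.univ.erase j).filter (· ∈ E) = E.erase j := by ext; simp
      rw [e1, Finset.sum_eq_zero (s := Finset.filter (fun x => x ∉ E) _), add_zero]
      · refine Finset.sum_congr rfl fun i hi => ?_
        rw [Finset.mem_erase] at hi
        simp [hr, hi.1, hi.2]
      · intro i hi
        simp only [Finset.mem_filter, Finset.mem_erase] at hi
        simp [hr, hi.1.1, hi.2]
    rw [h1]; simp [hr]; ring
  have hend : ∀ (t : ℝ) (E' : Finset (Fin n)), E' ⊆ E → (∀ i ∈ E', B i ≤ c - t) →
      (∀ i, ¬ q < v i → r t i = if i ∈ E' then B i else 0) →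
      s t = capState B y (above v q ∪ E') q (c - t) := by
    intro t E' hE' h1 h2
    have hq' : ∀ i ∈ E', ¬ q < v i := fun i hi => by rw [hEv i (hE' hi)]; exact lt_irrefl _
    simp only [hs, capState, State.mk.injEq, true_and]
    refine ⟨?_, ?_, ?_⟩ <;> funext i <;> by_cases hv : q < v i <;> by_cases hi : i ∈ E' <;>
      simp [hv, hi]
    -- An exiting bidder's budget is below the cap and her surplus is zero, so keeping her in the
    -- set or dropping her gives the same allocation `0`.
    · rw [hφ i (hE' hi), min_eq_left (h1 i hi)]; simp
    · rw [min_eq_left (h1 i hi)]; simp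
    · rw [h2 i hv, if_pos hi, min_eq_left (h1 i hi)]
    · rw [h2 i hv, if_neg hi]
  have h0 : s 0 = capState B y (above v q ∪ E) q c := by
    have := hend 0 E subset_rfl (fun i hi => by have := hBle i hi; linarith) fun i _ => by
      by_cases hij : i = j
      · subst hij; simp [hr, hj]
      · simp [hr, hij]
    rwa [sub_zero] at this
  have h1 : s (B j) = capState B y (above v q ∪ E.erase j) q (c - B j) :=
    hend (B j) _ (Finset.erase_subset _ _) (fun i hi => by have := hBle' i hi; linarith) fun i _ => by
      by_cases hij : i = j
      · subst hij; simp [hr]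
      · simp [hr, hij]
  have hsum : ∀ t, (s t).supply = 1 - ∑ i ∈ above v q,
      (surplus (spent (B i) y) q + (B i - min (B i) (c - t)) / q) := fun t => by
    rw [above, Finset.sum_filter]; rfl
  have hsup : ∀ t, q * (s t).supply = demand B (above v q) (c - t) + ∑ i ∈ E, B i - c := by
    intro t
    have e : ∀ t, q * (s t).supply = q * (1 - ∑ i ∈ above v q, surplus (spent (B i) y) q) -
        ∑ i ∈ above v q, B i + demand B (above v q) (c - t) := fun t => by
      rw [hsum, Finset.sum_add_distrib, ← Finset.sum_div, Finset.sum_sub_distrib, demand]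
      field_simp; ring
    have h2 : q * (s 0).supply = demand B (above v q) c + ∑ i ∈ E, B i - c := by
      rw [h0, hS, ← demand_eq_sum (G := E) fun i hi => (hBle i hi).trans hc.le, demand, demand,
        demand, Finset.sum_union (hdis E subset_rfl)]
    rw [e, sub_zero] at h2
    rw [e]; linarith
  have hcap : ∀ t ∈ Ico 0 (B j), IsCapped v B (s t) (c - t) (r t) := by
    intro t ht
    refine ⟨fun i => rfl, fun i hi => ?_, fun i => ?_, ?_, ?_⟩
    · have hiE : i ∉ E := fun h => hi (hEv i h)
      have hij : i ≠ j := fun h => hiE (h ▸ hj)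
      simp [hr, hiE, hij]
    · simp only [hr]
      split_ifs
      · linarith [ht.2]
      · exact (hB i).le
      · exact le_rfl
    · rw [hsr]; linarith
    · rw [hsr]
      have := hsup t
      change q * (s t).supply = demand B (above v q) (c - t) + _ - _
      linarith
  have hexit : ∀ t ∈ Ico 0 (B j), ∀ i, i ∈ (s t).exiting v ↔ i ∈ E := by
    intro t ht i
    rw [(hcap t ht).mem_exiting]
    by_cases hij : i = j
    · subst hij; simp [hr, hj, ht.2]
    · by_cases hi : i ∈ E
      · simp [hr, hij, hi, hB i]
      · simp [hr, hij, hi]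
  have hex : ∀ t ∈ Ico 0 (B j), (s t).exiting v ≠ ∅ := fun t ht he => by
    have := (hexit t ht j).2 hj
    rw [he] at this; simp at this
  have hrate : ∀ t ∈ Ico 0 (B j), (s t).extractionRate v = 1 := fun t ht => by
    rw [State.extractionRate, if_neg (hex t ht)]
  have hcl : ∀ t ∈ Ico 0 (B j), ∀ i, i ∈ (s t).clinching v ↔ q < v i ∧ c - t ≤ B i :=
    fun t ht i => (hcap t ht).mem_clinching hB
  have hlin : ∀ k : ℝ, RightFlow (fun t => k - t) (fun _ => -1) 0 (B j) := fun k =>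
    ⟨by fun_prop, fun t _ => ((hasDerivAt_id t).const_sub k).hasDerivWithinAt⟩
  have hmin : ∀ i, RightFlow (fun t => min (B i) (c - t))
      (fun t => if c - t ≤ B i then -1 else 0) 0 (B j) := fun i =>
    (hlin c).min_const (fun _ _ _ _ hab => sub_le_sub_left hab c) (B i)
  refine ⟨?_, ?_⟩
  · rw [← h0, ← h1]
    refine ClinchingOn.leads (s := s) (hB j).le ⟨?_, fun i => ?_, fun i => ?_, fun i => ?_,
      fun t ht => (hcap t ht).not_stops hB⟩
    · refine (rightFlow_const q 0 (B j)).congr (fun _ _ => rfl) fun t ht => ?_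
      rw [State.priceRate, if_neg (hex t ht)]
    · by_cases hi : q < v i
      · refine RightFlow.congr (g := fun t =>
          surplus (spent (B i) y) q + (B i - min (B i) (c - t)) / q)
          (r := fun t => -(if c - t ≤ B i then -1 else 0) / q)
          ⟨continuousOn_const.add ((continuousOn_const.sub (hmin i).cont).div_const q),
            fun z hz => ((((hmin i).deriv z hz).const_sub _).div_const q).const_add _⟩
          (fun t _ => by simp [hs, hi]) fun t ht => ?_
        rw [State.allocRate, hrate t ht]
        simp only [hcl t ht, hi, true_and]
        have : (s t).price = q := rfl
        rw [this]
        split_ifs <;> simp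
      · refine (rightFlow_const 0 _ _).congr (fun t _ => by simp [hs, hi]) fun t ht => ?_
        rw [State.allocRate, if_neg (by rw [hcl t ht]; tauto)]
    · by_cases hi : q < v i
      · refine RightFlow.congr (g := fun z => B i - min (B i) (c - z)) (r := fun t =>
          -(if c - t ≤ B i then -1 else 0))
          ⟨continuousOn_const.sub (hmin i).cont, fun z hz => ((hmin i).deriv z hz).const_sub _⟩
          (fun t _ => by simp [hs, hi]) fun t ht => ?_
        rw [State.paidRate, hrate t ht]
        simp only [hcl t ht, hi, true_and]
        split_ifs <;> simp
      · refine (rightFlow_const 0 _ _).congr (fun t _ => by simp [hs, hi]) fun t ht => ?_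
        rw [State.paidRate, if_neg (by rw [hcl t ht]; tauto)]
    · by_cases hi : q < v i
      · refine (hmin i).congr (fun t _ => by simp [hs, hi]) fun t ht => ?_
        have hiE : i ∉ E := fun h => by rw [hEv i h] at hi; exact lt_irrefl _ hi
        rw [State.budgetRate, hrate t ht]
        simp only [hcl t ht, hi, true_and, hexit t ht, hiE, false_and, if_false]
      · by_cases hij : i = j
        · subst hij
          refine (hlin (B i)).congr (fun t _ => by simp [hs, hi, hr]) fun t ht => ?_
          rw [State.budgetRate, if_neg (by rw [hcl t ht]; tauto), if_pos]
          exact ⟨(hexit t ht i).2 hj, fun k hk => hjmin k ((hexit t ht k).1 hk)⟩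
        · refine (rightFlow_const (if i ∈ E then B i else 0) _ _).congr
            (fun t _ => by simp [hs, hi, hr, hij]) fun t ht => ?_
          rw [State.budgetRate, if_neg (by rw [hcl t ht]; tauto), if_neg]
          rintro ⟨h2, h3⟩
          exact hij (le_antisymm (h3 j ((hexit t ht j).2 hj)) (hjmin i ((hexit t ht i).1 h2)))
  · rw [← h1, hsup, demand, demand, Finset.sum_union (hdis _ (Finset.erase_subset _ _)),
      Finset.sum_congr rfl fun i hi => min_eq_left ((hBle' i hi).trans (by linarith))]
    linarith

/-- All exiting bidders lose their effective budgets, one after the other. -/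
theorem exit_all (hB : ∀ j, 0 < B j) {q : ℝ} (hq : 0 < q) (N : ℕ) :
    ∀ (E : Finset (Fin n)) (c : ℝ), E.card = N → E ⊆ atVal v q → ∑ i ∈ E, B i < c →
    (∀ i ∈ E, surplus (spent (B i) y) q = 0) →
    q * (capState B y (above v q ∪ E) q c).supply = demand B (above v q ∪ E) c - c →
    Leads v (capState B y (above v q ∪ E) q c)
      (capState B y (above v q) q (c - ∑ i ∈ E, B i)) ∧
    q * (capState B y (above v q) q (c - ∑ i ∈ E, B i)).supply =
      demand B (above v q) (c - ∑ i ∈ E, B i) - (c - ∑ i ∈ E, B i) := by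
  induction N with
  | zero =>
    intro E c hN _ _ _ hS
    rw [Finset.card_eq_zero] at hN
    subst hN
    simp only [Finset.union_empty, Finset.sum_empty, sub_zero] at hS ⊢
    exact ⟨Leads.refl _, hS⟩
  | succ N ih =>
    intro E c hN hE hc hφ hS
    have hne : E.Nonempty := Finset.card_pos.1 (by omega)
    obtain ⟨h1, h2⟩ := exit_one hB hq hE (Finset.min'_mem E hne)
      (fun i hi => Finset.min'_le E i hi) hc hφ hS
    have hj := Finset.min'_mem E hne
    set j := E.min' hne
    have hsumE : ∑ i ∈ E.erase j, B i + B j = ∑ i ∈ E, B i := Finset.sum_erase_add _ _ hj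
    obtain ⟨h3, h4⟩ := ih (E.erase j) (c - B j) (by rw [Finset.card_erase_of_mem hj, hN]; rfl)
      ((Finset.erase_subset _ _).trans hE) (by linarith)
      (fun i hi => hφ i (Finset.mem_of_mem_erase hi)) h2
    have e : c - B j - ∑ i ∈ E.erase j, B i = c - ∑ i ∈ E, B i := by linarith
    rw [e] at h3 h4
    exact ⟨h1.trans h3, h4⟩

end

/-! ### From the path to the outcome of the auction. -/

section
variable {n : ℕ} {v B : Fin n → ℝ} {y : ℝ → ℝ}

theorem IsPath.le_of_tendsto (h : IsPath v B y) (hB : ∀ j, 0 < B j) {q l : ℝ}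
    (hl : Tendsto y (𝓝[<] q) (𝓝 l)) {z : ℝ} (hz : 0 < z) (hzq : z < q) : l ≤ y z := by
  refine _root_.le_of_tendsto hl ?_
  filter_upwards [Ioo_mem_nhdsLT hzq] with u hu
  exact h.antitoneOn hB hz (hz.trans hu.1) hu.1.le

/-- The auction does not stop when the exiting bidders have less budget than the cap. -/
theorem lt_of_demand_lt (hB : ∀ j, 0 < B j) {E : Finset (Fin n)} {l : ℝ} (hl : 0 ≤ l)
    (h : demand B E l < l) {i : Fin n} (hi : i ∈ E) : B i < l := by
  by_contra hc
  have := min_le_demand hB hl hi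
  rw [min_eq_right (not_lt.1 hc)] at this
  linarith

/-- The cap decreases towards `l`, so it never went below such a budget before `q`. -/
theorem IsPath.spent_eq_zero (h : IsPath v B y) (hB : ∀ j, 0 < B j) {q l : ℝ}
    (hl : Tendsto y (𝓝[<] q) (𝓝 l)) {i : Fin n} (hi : B i ≤ l) :
    ∀ z, 0 < z → z < q → spent (B i) y z = 0 := fun z hz hzq => by
  rw [spent, min_eq_left (hi.trans (h.le_of_tendsto hB hl hz hzq)), sub_self]

/-- The auction arrives at a state in which it stops. -/
theorem IsPath.exists_terminal (h : IsPath v B y) (hB : ∀ j, 0 < B j) (N : ℕ) :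
    ∀ p, 0 < p → (above v p).card = N → 0 < y p →
    p * (capState B y (above v p) p (y p)).supply = demand B (above v p) (y p) - y p →
    ∃ q l, p < q ∧ Tendsto y (𝓝[<] q) (𝓝 l) ∧ 0 < l ∧ l ≤ demand B (atVal v q) l ∧
      (∀ z ∈ Ico p q, 0 < y z) ∧
      Leads v (capState B y (above v p) p (y p)) (capState B y (above v q ∪ atVal v q) q l) ∧
      q * (capState B y (above v q ∪ atVal v q) q l).supply =
        demand B (above v q ∪ atVal v q) l - l := by
  induction N using Nat.strong_induction_on with
  | _ N ih =>
  intro p hp hN hy hS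
  have hne : (above v p).Nonempty := by
    by_contra hne
    rw [Finset.not_nonempty_iff_eq_empty] at hne
    have hc := (h.balanced hp).cases
    simp only [hne, demand, Finset.sum_empty, Finset.notMem_empty, false_and, exists_false,
      or_false] at hc
    rcases hc with hc | hc <;> linarith
  obtain ⟨q, hpq, hG, hun, hcard⟩ := exists_next hne
  have hq := hp.trans hpq
  obtain ⟨l, hl, he⟩ := h.jump hq
  obtain ⟨hpos, hl0⟩ := h.pos_of_flow hp hpq hG hl hy
  obtain ⟨h1, h2⟩ := h.rising hB hp hpq hG hl hy hS
  -- The first case is the stopping condition at `q`. In the second, every exiting budget is below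
  -- the cap, so these bidders have bought nothing and `exit_all` applies.
  rcases le_or_gt l (demand B (atVal v q) l) with hs | hs
  · refine ⟨q, l, hpq, hl, hl0, hs, hpos, ?_, ?_⟩
    · rw [← hun]; exact h1
    · rw [← hun]; exact h2
  have hlt : ∀ i ∈ atVal v q, B i < l := fun i hi => lt_of_demand_lt hB hl0.le hs hi
  have hd := demand_eq_sum fun i hi => (hlt i hi).le
  rw [hd] at hs he
  rw [max_eq_right (by linarith)] at he
  nth_rewrite 2 [hun] at h1
  rw [hun] at h2
  obtain ⟨h3, h4⟩ := exit_all (y := y) hB hq _ (atVal v q) l rfl subset_rfl hs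
    (fun i hi => surplus_eq_zero hq.le (h.spent_eq_zero hB hl (hlt i hi).le)) h2
  rw [← he] at h3 h4
  obtain ⟨q', l', hq', hl', hl0', hs', hpos', h5, h6⟩ := ih _ (hN ▸ hcard) q hq rfl
    (by rw [he]; linarith) h4
  refine ⟨q', l', hpq.trans hq', hl', hl0', hs', fun z hz => ?_, (h1.trans h3).trans h5, h6⟩
  rcases lt_or_ge z q with hzq | hzq
  · exact hpos z ⟨hz.1, hzq⟩
  · exact hpos' z ⟨hzq, hz.2⟩

/-- The initial state of the auction. -/
def initState (B : Fin n → ℝ) : State n := ⟨0, fun _ => 0, fun _ => 0, B⟩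

/-- At low prices, nothing is sold. -/
theorem leads_init (hB : ∀ j, 0 < B j) {a : ℝ} (ha : 0 < a)
    (hy : ∀ p ∈ Icc 0 a, y p = ∑ j, B j - p) (hv : ∀ j, a < v j)
    (hs : ∀ j, B j + a ≤ ∑ j, B j) (hn : 0 < n) :
    Leads v (initState B) (capState B y (above v a) a (y a)) ∧
      a * (capState B y (above v a) a (y a)).supply = demand B (above v a) (y a) - y a ∧
      0 < y a := by
  have hab : ∀ t, t ≤ a → above v t = Finset.univ := fun t ht => by
    ext i; simpa using ht.trans_lt (hv i)
  have hya := hy a ⟨ha.le, le_rfl⟩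
  have hsp : ∀ i, surplus (spent (B i) y) a = 0 := fun i => surplus_eq_zero ha.le fun z hz hza => by
    rw [spent, hy z ⟨hz.le, hza.le⟩, min_eq_left (by have := hs i; linarith), sub_self]
  set s : ℝ → State n := fun t => ⟨t, fun _ => 0, fun _ => 0, B⟩ with hsdef
  have hsup : ∀ t, (s t).supply = 1 := fun t => by simp [hsdef, State.supply]
  have hmin : ∀ t ≤ a, ∀ i, min (B i) (∑ j, B j - t) = B i := fun t ht i =>
    min_eq_left (by have := hs i; linarith)
  have hdem : ∀ t ≤ a, demand B Finset.univ (∑ j, B j - t) = ∑ j, B j := fun t ht =>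
    Finset.sum_congr rfl fun i _ => hmin t ht i
  have hpos : ∀ t ≤ a, 0 < ∑ j, B j - t := fun t ht => by
    have := hs ⟨0, hn⟩; have := hB ⟨0, hn⟩; linarith
  have hcap : ∀ t ∈ Ico 0 a, IsCapped v B (s t) (∑ j, B j - t) fun _ => 0 := fun t ht => by
    refine ⟨fun i => ?_, fun _ _ => rfl, fun _ => le_rfl, by simpa using hpos t ht.2.le, ?_⟩
    · rw [hmin t ht.2.le, if_pos (show (s t).price < v i from ht.2.trans (hv i))]
    · change t * _ = demand B (above v t) _ + _ - _
      rw [hsup, hab t ht.2.le, hdem t ht.2.le]; simp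
  have hex : ∀ t ∈ Ico 0 a, (s t).exiting v = ∅ := fun t ht => by
    ext i; rw [(hcap t ht).mem_exiting]; simp
  have hcl : ∀ t ∈ Ico 0 a, ∀ i, i ∉ (s t).clinching v := fun t ht i hi => by
    rw [(hcap t ht).mem_clinching hB] at hi
    have := hs i; linarith [hi.2, ht.2]
  have hend : s a = capState B y (above v a) a (y a) := by
    simp only [hsdef, capState, State.mk.injEq, true_and, hab a le_rfl, Finset.mem_univ, if_true,
      hya, hmin a le_rfl, hsp]
    simp
  refine ⟨?_, ?_, by rw [hya]; exact hpos a le_rfl⟩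
  · rw [← hend]
    refine ClinchingOn.leads (s := s) ha.le ⟨⟨continuousOn_id, fun t ht => ?_⟩, fun i => ?_,
      fun i => ?_, fun i => ?_, fun t ht => (hcap t ht).not_stops hB⟩
    · rw [State.priceRate, if_pos (hex t ht)]
      exact (hasDerivAt_id t).hasDerivWithinAt
    · refine (rightFlow_const 0 0 a).congr (fun _ _ => rfl) fun t ht => ?_
      rw [State.allocRate, if_neg (hcl t ht i)]
    · refine (rightFlow_const 0 0 a).congr (fun _ _ => rfl) fun t ht => ?_
      rw [State.paidRate, if_neg (hcl t ht i)]
    · refine (rightFlow_const (B i) 0 a).congr (fun _ _ => rfl) fun t ht => ?_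
      rw [State.budgetRate, if_neg (hcl t ht i)]
      simp [hex t ht]
  · rw [← hend, hsup, hab a le_rfl, hya, hdem a le_rfl]; ring

theorem Leads.isClinchingRun {s₁ : State n} (h : Leads v (initState B) s₁) (hs : s₁.Stops v) :
    ∃ s f, IsClinchingRun v B s f ∧ s f = s₁ := by
  obtain ⟨s, b, hb, hc, h0, h1⟩ := h
  exact ⟨s, b, ⟨hb, by simp [h0, initState], by simp [h0, initState], by simp [h0, initState],
    by simp [h0, initState], hc.price.cont, fun i => (hc.alloc i).cont, fun i => (hc.paid i).cont,
    fun i => (hc.budget i).cont, hc.not_stops, by rw [h1]; exact hs, hc.price.deriv,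
    fun t ht i => (hc.alloc i).deriv t ht, fun t ht i => (hc.paid i).deriv t ht,
    fun t ht i => (hc.budget i).deriv t ht⟩, h1⟩

/-- The properties of the outcome of the clinching auction that matter for the incentives: for every
bidder `i`, if `y'` is the path on which `i` stays in the auction beyond her report, then she buys
everything that is bought on `y'` below her report, and some part of what is bought there at it. -/
structure IsGoodOutcome (v B X P : Fin n → ℝ) : Prop where
  total : ∑ i, X i = 1
  pay_nonneg : ∀ i, 0 ≤ P i
  pay_le : ∀ i, P i ≤ B i
  exhausted : ∀ i j, 0 < X i → v i < v j → P j = B j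
  spent_le : ∀ i K y', v i < K → IsPath (Function.update v i K) B y' →
    ∀ q, 0 < q → q < v i → spent (B i) y' q ≤ P i
  le_spent : ∀ i K y', v i < K → IsPath (Function.update v i K) B y' →
    P i ≤ spent (B i) y' (v i)
  alloc_eq : ∀ i K y', v i < K → IsPath (Function.update v i K) B y' →
    X i = surplus (spent (B i) y') (v i) + P i / v i

/-- Once the active bidders have spent their budgets at the final price, supply worth `T - l`
remains, where `T` is the total effective budget of the exiting bidders. The rules leave its
division open; here it is shared in proportion to effective budgets. -/
theorem exists_outcome (hn : 2 ≤ n) (hv : ∀ j, 0 < v j) (hB : ∀ j, 0 < B j) :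
    ∃ X P, IsClinchingOutcome v B X P ∧ IsGoodOutcome v B X P := by
  have : Nontrivial (Fin n) := Fin.nontrivial_iff_two_le.2 hn
  obtain ⟨y, h⟩ := exists_isPath hv hB
  obtain ⟨a, ha, hya, hav, has⟩ := h.init
  obtain ⟨l1, hS, hy0⟩ := leads_init hB ha hya hav has (by omega)
  obtain ⟨q, l, haq, hl, hl0, hT, hpos, l2, hS'⟩ := h.exists_terminal hB _ a ha rfl hy0 hS
  have hq := ha.trans haq
  set G := above v q ∪ atVal v q with hG
  set T := demand B (atVal v q) l with hTdef
  have hT0 : 0 < T := hl0.trans_le hT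
  set sf := capState B y G q l with hsf
  have hGm : ∀ i, i ∈ G ↔ q ≤ v i := fun i => by
    rw [hG, Finset.mem_union, mem_above, mem_atVal, le_iff_lt_or_eq, eq_comm (a := v i)]
  have hm0 : ∀ i, 0 < min (B i) l := fun i => lt_min (hB i) hl0
  have hact : sf.active v = above v q := by
    ext i
    simp only [State.active, Finset.mem_filter, Finset.mem_univ, true_and, mem_above]
    refine ⟨fun h => h.1, fun h => ⟨h, ?_⟩⟩
    simp only [hsf, capState, if_pos ((hGm i).2 h.le)]
    exact hm0 i
  have hexi : sf.exiting v = atVal v q := by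
    ext i
    simp only [State.exiting, Finset.mem_filter, Finset.mem_univ, true_and, mem_atVal]
    refine ⟨fun h => h.1, fun h => ⟨h, ?_⟩⟩
    simp only [hsf, capState, if_pos ((hGm i).2 h.ge)]
    exact hm0 i
  have hdis := disjoint_above_atVal v q
  have hdem : demand B G l = demand B (above v q) l + T := Finset.sum_union hdis
  rw [hdem] at hS'
  have hst : sf.Stops v := by
    rw [State.Stops, hact]
    change _ ≤ q * sf.supply
    rw [hS']
    have : ∑ i ∈ above v q, sf.budget i = demand B (above v q) l :=
      Finset.sum_congr rfl fun i hi => by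
        simp [hsf, capState, (hGm i).2 (mem_above.1 hi).le]
    rw [this]; linarith
  obtain ⟨s, f, hrun, hsf'⟩ := (l1.trans l2).isClinchingRun hst
  -- the final one-shot payments
  set e : Fin n → ℝ := fun i =>
    if q < v i then min (B i) l else if v i = q then min (B i) l * (T - l) / T else 0 with he
  have hee : ∀ i, v i = q → 0 ≤ e i ∧ e i ≤ min (B i) l ∧ e i ≤ T - l := by
    intro i hi
    have hle : min (B i) l ≤ T := min_le_demand hB hl0.le (mem_atVal.2 hi)
    have h1 : e i = min (B i) l * (T - l) / T := by simp [he, hi]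
    have h2 := hm0 i
    have h3 : 0 ≤ T - l := by linarith
    rw [h1]
    refine ⟨by positivity, ?_, ?_⟩
    · rw [div_le_iff₀ hT0]; nlinarith
    · rw [div_le_iff₀ hT0]; nlinarith
  set X : Fin n → ℝ := fun i => sf.alloc i + e i / q with hX
  set P : Fin n → ℝ := fun i => sf.paid i + e i with hP
  have hesum : ∑ i, e i = demand B (above v q) l + (T - l) := by
    have h1 : ∑ i, e i = ∑ i ∈ G, e i := by
      refine (Finset.sum_subset (Finset.subset_univ _) fun i _ hi => ?_).symm
      rw [hGm, not_le] at hi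
      simp [he, not_lt.2 hi.le, hi.ne]
    rw [h1, hG, Finset.sum_union hdis]
    congr 1
    · exact Finset.sum_congr rfl fun i hi => by simp [he, mem_above.1 hi]
    · have : ∀ i ∈ atVal v q, e i = min (B i) l * ((T - l) / T) := fun i hi => by
        simp [he, mem_atVal.1 hi, mul_div_assoc]
      rw [Finset.sum_congr rfl this, ← Finset.sum_mul]
      change T * _ = _
      field_simp
  have hXhi : ∀ i, q ≤ v i → X i = surplus (spent (B i) y) q + P i / q := fun i hi => by
    simp only [hX, hP, hsf, capState, (hGm i).2 hi, if_true]; ring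
  have hXlo : ∀ i, v i < q → X i = 0 ∧ P i = 0 := fun i hi => by
    have h1 : i ∉ G := by rw [hGm]; exact not_le.2 hi
    have h2 : e i = 0 := by simp [he, not_lt.2 hi.le, hi.ne]
    simp [hX, hP, hsf, capState, h1, h2]
  have hPhi : ∀ i, q < v i → P i = B i := fun i hi => by
    simp [hP, hsf, capState, (hGm i).2 hi.le, he, hi]
  have hPeq : ∀ i, v i = q → P i = B i - min (B i) l + e i := fun i hi => by
    simp [hP, hsf, capState, (hGm i).2 hi.ge]
  have htot : ∑ i, X i = 1 := by
    have h1 : q * sf.supply = q * (1 - ∑ i, sf.alloc i) := rfl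
    rw [h1] at hS'
    have h2 : q * ∑ i, X i = q := by
      simp only [hX]
      rw [Finset.sum_add_distrib, ← Finset.sum_div, hesum, mul_add, mul_div_cancel₀ _ hq.ne']
      linarith
    exact mul_left_cancel₀ hq.ne' (by rw [h2, mul_one])
  -- The stopping condition is exactly the one under which the path drops to `0`; from then on whole
  -- budgets count as spent.
  have hyq : y q = 0 := by
    obtain ⟨l', hl', hh⟩ := h.jump hq
    have := tendsto_nhds_unique hl' hl
    subst this
    rw [hh, max_eq_left (by linarith)]
  have hy_zero : ∀ z, q ≤ z → y z = 0 := fun z hz =>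
    le_antisymm (hyq ▸ h.antitoneOn hB hq (hq.trans_le hz) hz) (h.balanced (hq.trans_le hz)).nonneg
  -- bidders who exited before the end have bought nothing
  have hexited : ∀ i, v i < q → ∀ z, 0 < z → z < v i → spent (B i) y z = 0 := by
    intro i hi
    obtain ⟨l', hl', hh⟩ := h.jump (hv i)
    refine h.spent_eq_zero hB hl' (le_of_lt ?_)
    have hl0' : 0 ≤ l' := nonneg_of_tendsto_nhdsLT (hv i) hl' fun p hp => (h.balanced hp).nonneg
    have h1 := hpos (v i) ⟨(hav i).le, hi⟩
    rw [hh] at h1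
    refine lt_of_demand_lt (E := atVal v (v i)) hB hl0' ?_ (by simp)
    rcases lt_max_iff.1 h1 with h2 | h2
    · exact absurd h2 (lt_irrefl _)
    · linarith
  have hagree : ∀ i K y', v i < K → IsPath (Function.update v i K) B y' →
      ∀ z, 0 < z → z < v i → y z = y' z := fun i K y' hK h' z hz hzv =>
    h.eq_of_lt h' hB (fun j hj => Function.update_of_ne hj _ _) hz hzv
      (by simpa using hzv.trans hK)
  have hsagree : ∀ i K y', v i < K → IsPath (Function.update v i K) B y' →
      ∀ z, 0 < z → z < v i → spent (B i) y' z = spent (B i) y z := fun i K y' hK h' z hz hzv => by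
    rw [spent, spent, hagree i K y' hK h' z hz hzv]
  refine ⟨X, P, ⟨s, f, hrun, ?_⟩, htot, fun i => ?_, fun i => ?_, fun i j hi hij => ?_, ?_, ?_, ?_⟩
  · rw [hsf']
    refine ⟨htot, fun i => ?_, fun i hi => ?_, fun i hi => ?_, fun i hi hi' => ?_⟩
    · change sf.paid i + e i = sf.paid i + q * (sf.alloc i + e i / q - sf.alloc i)
      field_simp; ring
    · rw [hact, mem_above] at hi
      change sf.alloc i + e i / q = sf.alloc i + sf.budget i / q
      simp [hsf, capState, (hGm i).2 hi.le, he, hi]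
    · rw [hexi, mem_atVal] at hi
      obtain ⟨h1, h2, -⟩ := hee i hi
      have hb : sf.budget i = min (B i) l := by simp [hsf, capState, (hGm i).2 hi.ge]
      rw [hb]
      change sf.alloc i ≤ sf.alloc i + e i / q ∧ q * (sf.alloc i + e i / q - sf.alloc i) ≤ _
      constructor
      · have : 0 ≤ e i / q := by positivity
        linarith
      · rw [add_sub_cancel_left, mul_div_cancel₀ _ hq.ne']; exact h2
    · rw [hact, mem_above] at hi
      rw [hexi, mem_atVal] at hi'
      simp [hX, he, hi, hi']
  · rcases lt_trichotomy (v i) q with hi | hi | hi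
    · rw [(hXlo i hi).2]
    · rw [hPeq i hi]; have := min_le_left (B i) l; have := (hee i hi).1; linarith
    · rw [hPhi i hi]; exact (hB i).le
  · rcases lt_trichotomy (v i) q with hi | hi | hi
    · rw [(hXlo i hi).2]; exact (hB i).le
    · rw [hPeq i hi]; have := (hee i hi).2.1; linarith
    · rw [hPhi i hi]
  · refine hPhi j (lt_of_le_of_lt ?_ hij)
    by_contra hc
    rw [(hXlo i (not_le.1 hc)).1] at hi
    exact lt_irrefl _ hi
  · intro i K y' hK h' z hz hzv
    rw [hsagree i K y' hK h' z hz hzv]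
    rcases lt_trichotomy (v i) q with hi | hi | hi
    · rw [(hXlo i hi).2, hexited i hi z hz hzv]
    · rw [hPeq i hi, spent]
      have := min_le_min_left (B i) (h.le_of_tendsto hB hl hz (hi ▸ hzv))
      have := (hee i hi).1; linarith
    · rw [hPhi i hi]; exact (h.isSpending hB i).le z hz
  · intro i K y' hK h'
    rcases lt_trichotomy (v i) q with hi | hi | hi
    · rw [(hXlo i hi).2]; exact (h'.isSpending hB i).nonneg _ (hv i)
    · rw [hPeq i hi, spent]
      obtain ⟨l', hl', hh⟩ := h'.jump (hv i)
      have hll : l' = l := by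
        refine tendsto_nhds_unique hl' ?_
        rw [hi]
        exact tendsto_nhdsLT_congr hq hl fun z hz =>
          (hagree i K y' hK h' z hz.1 (hi ▸ hz.2)).symm
      subst hll
      -- On `y'` bidder `i` does not exit here, so the cap drops only by the capped budgets of the
      -- others. The bounds on `e i` by `min (B i) l` and by `T - l` then keep her payment within
      -- what is spent on `y'`.
      have hat : atVal (Function.update v i K) (v i) = (atVal v q).erase i := by
        ext j
        by_cases hj : j = i
        · subst hj; simp [hK.ne']
        · simp [hj, hi]
      have hd := demand_erase (B := B) (y := l') (mem_atVal.2 hi)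
      rw [hh, hat]
      obtain ⟨h1, h2, h3⟩ := hee i hi
      have h4 : max 0 (l' - demand B ((atVal v q).erase i) l') ≤ min (B i) l' - e i :=
        max_le (by linarith) (by linarith)
      have := min_le_right (B i) (max 0 (l' - demand B ((atVal v q).erase i) l'))
      linarith
    · have h1 : y' (v i) ≤ 0 := by
        have := h'.antitoneOn hB hq (hv i) hi.le
        rwa [← hagree i K y' hK h' q hq hi, hyq] at this
      rw [hPhi i hi, spent]
      have := min_le_right (B i) (y' (v i)); linarith
  · intro i K y' hK h'
    rw [surplus_congr (hv i).le (hsagree i K y' hK h')]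
    rcases lt_trichotomy (v i) q with hi | hi | hi
    · rw [(hXlo i hi).1, (hXlo i hi).2, surplus_eq_zero (hv i).le (hexited i hi)]; simp
    · rw [hXhi i hi.ge, hi]
    · rw [hXhi i hi.le, hPhi i hi]
      -- From `q` to `v i` the path is `0` and spending is constantly `B i`; this part of the
      -- integral converts `B i / q` into `B i / v i`.
      have h1 := (h.isSpending hB i).surplus_sub hq.le (hv i).le
      have h2 := (integral_const_div_sq (B i) hq hi.le).2
      have h3 : ∫ z in q..v i, spent (B i) y z / z ^ 2 = ∫ z in q..v i, B i / z ^ 2 := by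
        refine intervalIntegral.integral_congr fun z hz => ?_
        rw [uIcc_of_le hi.le] at hz
        simp only [spent, hy_zero z hz.1, min_eq_right (hB i).le, sub_zero]
      rw [h3, h2] at h1
      have : B i * (1 / q - 1 / v i) = B i / q - B i / v i := by ring
      linarith

end

/-! ### Incentives in the deterministic auction. -/

section
section deterministic
variable {n : ℕ} {v B X P : Fin n → ℝ}

/-- With a truthful report, the utility is the surplus on the path without exit. -/
theorem IsGoodOutcome.utility_eq (h : IsGoodOutcome v B X P) (hv : ∀ j, 0 < v j) {i : Fin n} {K : ℝ}
    {y : ℝ → ℝ} (hK : v i < K) (hy : IsPath (Function.update v i K) B y) :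
    v i * X i - P i = v i * surplus (spent (B i) y) (v i) := by
  rw [h.alloc_eq i K y hK hy, mul_add, mul_div_cancel₀ _ (hv i).ne']; ring

/-- With any report, the utility is at most the surplus on the path without exit. -/
theorem IsGoodOutcome.utility_le (h : IsGoodOutcome v B X P) (hv : ∀ j, 0 < v j)
    (hB : ∀ j, 0 < B j) {i : Fin n} {K η : ℝ} {y : ℝ → ℝ} (hη : 0 < η) (hK : v i < K)
    (hy : IsPath (Function.update v i K) B y) :
    η * X i - P i ≤ η * surplus (spent (B i) y) η := by
  have h1 := (hy.isSpending hB i).add_le_surplus (hv i) hη (h.spent_le i K y hK hy)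
    (h.le_spent i K y hK hy)
  rw [h.alloc_eq i K y hK hy]
  have h2 : η * (surplus (spent (B i) y) (v i) + P i / v i) - P i =
      η * (surplus (spent (B i) y) (v i) + P i * (1 / v i - 1 / η)) := by
    field_simp; ring
  rw [h2]
  gcongr

theorem exists_path_beyond (hn : 2 ≤ n) (hv : ∀ j, 0 < v j) (hB : ∀ j, 0 < B j) (i : Fin n) {K : ℝ}
    (hK : 0 < K) : ∃ y, IsPath (Function.update v i K) B y := by
  have : Nontrivial (Fin n) := Fin.nontrivial_iff_two_le.2 hn
  refine exists_isPath (fun j => ?_) hB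
  by_cases hj : j = i
  · subst hj; simpa
  · simpa [hj] using hv j

theorem IsGoodOutcome.utility_nonneg (h : IsGoodOutcome v B X P) (hn : 2 ≤ n) (hv : ∀ j, 0 < v j)
    (hB : ∀ j, 0 < B j) (i : Fin n) : 0 ≤ v i * X i - P i := by
  have := hv i
  obtain ⟨y, hy⟩ := exists_path_beyond hn hv hB i (K := v i + 1) (by linarith)
  rw [h.utility_eq hv (by linarith) hy]
  exact mul_nonneg this.le ((hy.isSpending hB i).surplus_nonneg this.le)

theorem IsGoodOutcome.alloc_nonneg (h : IsGoodOutcome v B X P) (hn : 2 ≤ n) (hv : ∀ j, 0 < v j)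
    (hB : ∀ j, 0 < B j) (i : Fin n) : 0 ≤ X i := by
  have h1 := h.utility_nonneg hn hv hB i
  have h2 := h.pay_nonneg i
  have h3 : 0 ≤ v i * X i := by linarith
  exact nonneg_of_mul_nonneg_right h3 (hv i)

/-- Nothing is sold for free. -/
theorem IsGoodOutcome.alloc_eq_zero (h : IsGoodOutcome v B X P) (hn : 2 ≤ n) (hv : ∀ j, 0 < v j)
    (hB : ∀ j, 0 < B j) {i : Fin n} (hP : P i = 0) : X i = 0 := by
  have := hv i
  obtain ⟨y, hy⟩ := exists_path_beyond hn hv hB i (K := v i + 1) (by linarith)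
  have hK : v i < v i + 1 := by linarith
  rw [h.alloc_eq i _ y hK hy, hP, surplus_eq_zero this.le, zero_div, add_zero]
  intro q hq hqv
  have h1 := h.spent_le i _ y hK hy q hq hqv
  exact le_antisymm (hP ▸ h1) ((hy.isSpending hB i).nonneg q hq)

/-- No report with a smaller or equal budget is better than the truth. -/
theorem IsGoodOutcome.utility_le_truth {X' P' : Fin n → ℝ} {i : Fin n} {w b : ℝ}
    (h : IsGoodOutcome v B X P)
    (h' : IsGoodOutcome (Function.update v i w) (Function.update B i b) X' P') (hn : 2 ≤ n)
    (hv : ∀ j, 0 < v j) (hB : ∀ j, 0 < B j) (hw : 0 < w) (hb : 0 < b) (hbB : b ≤ B i) :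
    v i * X' i - P' i ≤ v i * X i - P i := by
  have hv' : ∀ j, 0 < Function.update v i w j := fun j => by
    by_cases hj : j = i
    · subst hj; simpa
    · simpa [hj] using hv j
  have hB' : ∀ j, 0 < Function.update B i b j := fun j => by
    by_cases hj : j = i
    · subst hj; simpa
    · simpa [hj] using hB j
  -- With `K` above both the true and the reported valuation, one path for each budget suffices: the
  -- misreport is bounded by the surplus for budget `b`, which is at most the surplus for `B i`.
  set K := max (v i) w + 1 with hKdef
  have hK1 : v i < K := by have := le_max_left (v i) w; linarith
  have hK2 : w < K := by have := le_max_right (v i) w; linarith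
  obtain ⟨y, hy⟩ := exists_path_beyond hn hv hB i (K := K) (by linarith [hv i])
  obtain ⟨y', hy'⟩ := exists_path_beyond hn hv hB' i (K := K) (by linarith [hv i])
  have h1 := h'.utility_le hv' hB' (i := i) (K := K) (hv i) (by simpa using hK2)
    (by rw [Function.update_idem]; exact hy')
  rw [h.utility_eq hv hK1 hy]
  refine h1.trans (mul_le_mul_of_nonneg_left ?_ (hv i).le)
  refine surplus_mono (hy'.isSpending hB' i) (hy.isSpending hB i) (hv i).le fun q hq hqv => ?_
  exact spent_mono hy hy' hB (fun _ _ => rfl) (fun j hj => Function.update_of_ne hj _ _)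
    (by simpa using hbB) hq (by simpa using hqv.trans hK1) (by simpa using hqv.trans hK1)

end deterministic

/-! ### The lottery and its expected utilities. -/

section lottery

theorem tsum_map_mul {α β : Type*} (μ : PMF α) (f : α → β) (h : β → ℝ≥0∞) :
    ∑' b, μ.map f b * h b = ∑' a, μ a * h (f a) := by
  classical
  simp only [PMF.map_apply, ← ENNReal.tsum_mul_right]
  rw [ENNReal.tsum_comm]
  refine tsum_congr fun a => ?_
  rw [tsum_eq_single (f a) fun b hb => by simp [hb]]
  simp

/-- There is a law on the product with given marginals on finitely many factors. -/
theorem exists_pmf_marginals {ι α : Type*} [Inhabited α] (ν : ι → PMF α) (s : Finset ι) :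
    ∃ μ : PMF (ι → α), ∀ i ∈ s, μ.map (fun f => f i) = ν i := by
  classical
  induction s using Finset.induction_on with
  | empty => exact ⟨PMF.pure fun _ => default, by simp⟩
  | insert a s ha ih =>
    obtain ⟨μ, hμ⟩ := ih
    refine ⟨(ν a).bind fun x => μ.map fun f => Function.update f a x, fun i hi => ?_⟩
    simp only [PMF.map_bind, PMF.map_comp]
    by_cases hia : i = a
    · subst hia
      have : ∀ x : α, μ.map ((fun f : ι → α => f i) ∘ fun f => Function.update f i x) =
          PMF.pure x := fun x => by
        rw [← PMF.map_const μ x]; congr 1; funext f; simp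
      simp only [this, PMF.bind_pure]
    · have : ∀ x : α, μ.map ((fun f : ι → α => f i) ∘ fun f => Function.update f a x) = ν i :=
        fun x => by
          rw [← hμ i (Finset.mem_of_mem_insert_of_ne hi hia)]
          congr 1; funext f; simp [hia]
      simp only [this, PMF.bind_const]

/-- The law of a payment: `b` with probability `x`, and `0` otherwise. -/
theorem exists_pmf_pay {x b : ℝ} (hx0 : 0 ≤ x) (hx1 : x ≤ 1) (hb : 0 < b) :
    ∃ ν : PMF ℝ, ν b = ENNReal.ofReal x ∧ ν 0 = ENNReal.ofReal (1 - x) ∧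
      (∀ z ∈ ν.support, z = b ∨ z = 0) ∧
      ∑' z, ν z * ENNReal.ofReal z = ENNReal.ofReal (x * b) := by
  have h1 : ∑ c : Bool, (if c then ENNReal.ofReal x else ENNReal.ofReal (1 - x)) = 1 := by
    rw [Fintype.sum_bool]
    simp only [if_true, Bool.false_eq_true, if_false]
    rw [← ENNReal.ofReal_add hx0 (by linarith)]; simp
  refine ⟨(PMF.ofFintype _ h1).map fun c => if c then b else 0, ?_, ?_, ?_, ?_⟩
  · rw [PMF.map_apply, tsum_fintype, Fintype.sum_bool]; simp [hb.ne']
  · rw [PMF.map_apply, tsum_fintype, Fintype.sum_bool]; simp [hb.ne]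
  · intro z hz
    obtain ⟨c, -, rfl⟩ := (PMF.mem_support_map_iff _ _ _).1 hz
    cases c <;> simp
  · rw [tsum_map_mul, tsum_fintype, Fintype.sum_bool]
    simp [ENNReal.ofReal_mul hx0]

variable {n : ℕ}

/-- What is used of the lottery over outcomes. -/
structure IsGoodLottery (m : ℕ) (B X P : Fin n → ℝ) (μ : PMF (Outcome n)) : Prop where
  isLottery : IsLottery m B X P μ
  units_mem : ∀ o ∈ μ.support, ∃ k, 0 < X k ∧ o.units = allTo m k
  pay_mem : ∀ o ∈ μ.support, ∀ i, o.pay i = B i ∨ o.pay i = 0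
  pay_full : ∀ o ∈ μ.support, ∀ i, P i = B i → o.pay i = B i
  pay_none : ∀ o ∈ μ.support, ∀ i, P i = 0 → o.pay i = 0
  exists_pay : ∀ i, 0 < P i → ∃ o ∈ μ.support, o.pay i = B i
  expected_units : ∀ i (t : ℝ), 0 ≤ t →
    ∑' o, μ o * ENNReal.ofReal (t * o.units i) = ENNReal.ofReal (t * (m * X i))
  expected_pay : ∀ i, ∑' o, μ o * ENNReal.ofReal (o.pay i) = ENNReal.ofReal (P i)

/-- The winner is drawn independently of the payments, but only marginal laws enter, because without
a budget violation the utility is a sum of a term in the units and a term in the payment. -/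
theorem exists_lottery {m : ℕ} (hm : 1 ≤ m) {B X P : Fin n → ℝ} (hB : ∀ i, 0 < B i)
    (hX : ∀ i, 0 ≤ X i) (hX1 : ∑ i, X i = 1) (hP : ∀ i, 0 ≤ P i) (hPB : ∀ i, P i ≤ B i) :
    ∃ μ : PMF (Outcome n), IsGoodLottery m B X P μ := by
  have h1 : ∑ i, ENNReal.ofReal (X i) = 1 := by
    rw [← ENNReal.ofReal_sum_of_nonneg fun i _ => hX i, hX1, ENNReal.ofReal_one]
  set pX := PMF.ofFintype _ h1 with hpX
  choose ν hνB hν0 hνmem hνE using fun i => exists_pmf_pay (x := P i / B i) (b := B i)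
    (div_nonneg (hP i) (hB i).le) ((div_le_one (hB i)).2 (hPB i)) (hB i)
  obtain ⟨pP, hpP'⟩ := exists_pmf_marginals ν Finset.univ
  have hpP : ∀ i, pP.map (fun f => f i) = ν i := fun i => hpP' i (Finset.mem_univ i)
  set μ : PMF (Outcome n) := pX.bind fun k => pP.map fun f => ⟨allTo m k, f⟩ with hμ
  have hunits : μ.map (fun o => o.units) = pX.map (allTo m) := by
    rw [hμ, PMF.map_bind]
    have : ∀ k, (pP.map fun f => (⟨allTo m k, f⟩ : Outcome n)).map (fun o => o.units) =
        PMF.pure (allTo m k) := fun k => by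
      rw [PMF.map_comp, ← PMF.map_const pP (allTo m k)]; rfl
    simp only [this]; rfl
  have hpay : ∀ i, μ.map (fun o => o.pay i) = ν i := fun i => by
    rw [hμ, PMF.map_bind]
    have : ∀ k, (pP.map fun f => (⟨allTo m k, f⟩ : Outcome n)).map (fun o => o.pay i) = ν i :=
      fun k => by rw [PMF.map_comp, ← hpP i]; rfl
    simp only [this, PMF.bind_const]
  have hinj : Function.Injective (allTo (n := n) m) := fun i j hij => by
    by_contra hne
    have := congrFun hij i
    simp [allTo, hne] at this
    omega
  have hsup : ∀ o ∈ μ.support, ∀ i, o.pay i ∈ (ν i).support := fun o ho i => by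
    rw [← hpay i]; exact (PMF.mem_support_map_iff _ _ _).2 ⟨o, ho, rfl⟩
  refine ⟨μ, ⟨fun i => ?_, fun i => ?_, fun i => ?_⟩, fun o ho => ?_, fun o ho i => ?_,
    fun o ho i hi => ?_, fun o ho i hi => ?_, fun i hi => ?_, fun i t ht => ?_, fun i => ?_⟩
  · rw [hunits, PMF.map_apply, tsum_eq_single i fun j hj => by simp [hinj.eq_iff, hj.symm]]
    simp [hpX]
  · rw [hpay, hνB]
  · rw [hpay, hν0]
  · have : o.units ∈ (pX.map (allTo m)).support := by
      rw [← hunits]; exact (PMF.mem_support_map_iff _ _ _).2 ⟨o, ho, rfl⟩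
    obtain ⟨k, hk, hko⟩ := (PMF.mem_support_map_iff _ _ _).1 this
    refine ⟨k, ?_, hko.symm⟩
    rw [hpX, PMF.mem_support_ofFintype_iff] at hk
    simpa using hk
  · exact hνmem i _ (hsup o ho i)
  -- If `P i = B i`, the payment `0` has probability zero. Ex post Pareto optimality rests on this.
  · rcases hνmem i _ (hsup o ho i) with h | h
    · exact h
    · have h2 := hsup o ho i
      rw [h, PMF.mem_support_iff, hν0, hi, div_self (hB i).ne'] at h2
      simp at h2
  · rcases hνmem i _ (hsup o ho i) with h | h
    · have h2 := hsup o ho i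
      rw [h, PMF.mem_support_iff, hνB, hi] at h2
      simp at h2
    · exact h
  · have : B i ∈ (ν i).support := by
      rw [PMF.mem_support_iff, hνB]
      have := div_pos hi (hB i)
      simpa using this
    rw [← hpay i] at this
    exact (PMF.mem_support_map_iff _ _ _).1 this
  · rw [← tsum_map_mul μ (fun o => o.units) fun u => ENNReal.ofReal (t * u i), hunits,
      tsum_map_mul, tsum_eq_single i fun j hj => by simp [allTo, hj.symm], hpX,
      PMF.ofFintype_apply, ← ENNReal.ofReal_mul (hX i)]
    simp only [allTo, if_true]
    congr 1; ring
  · rw [← tsum_map_mul μ (fun o => o.pay i) fun z => ENNReal.ofReal z, hpay, hνE,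
      div_mul_cancel₀ _ (hB i).ne']

/-- The expected utility of a bidder who cannot be charged more than her true budget. -/
theorem IsGoodLottery.expectedUtility_eq {m : ℕ} {B X P : Fin n → ℝ} {μ : PMF (Outcome n)}
    (h : IsGoodLottery m B X P μ) {i : Fin n} (hX : 0 ≤ X i) (hP : 0 ≤ P i) {η β : ℝ} (hη : 0 ≤ η)
    (hB : 0 ≤ B i) (hβ : ∀ o ∈ μ.support, o.pay i ≤ β) :
    expectedUtility η β i μ = ((η * (m * X i) - P i : ℝ) : EReal) := by
  have hu : ∀ o ∈ μ.support, utility η β i o = ((η * o.units i - o.pay i : ℝ) : EReal) :=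
    fun o ho => by rw [utility, if_neg (not_lt.2 (hβ o ho))]
  have hpay : ∀ o ∈ μ.support, 0 ≤ o.pay i := fun o ho => by
    rcases h.pay_mem o ho i with h1 | h1 <;> rw [h1]
    exact hB
  set U := ∑' o, μ o * (utility η β i o).toENNReal with hU
  set V := ∑' o, μ o * (-(utility η β i o)).toENNReal with hV
  -- Moving the payment and the value to opposite sides avoids truncated subtraction; the difference
  -- is taken only after `U` and `V` are known to be finite.
  have hsum : U + ENNReal.ofReal (P i) = V + ENNReal.ofReal (η * (m * X i)) := by
    rw [← h.expected_pay i, ← h.expected_units i η hη, hU, hV, ← ENNReal.tsum_add,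
      ← ENNReal.tsum_add]
    refine tsum_congr fun o => ?_
    by_cases ho : μ o = 0
    · simp [ho]
    have ho' : o ∈ μ.support := (PMF.mem_support_iff _ _).2 ho
    rw [← mul_add, ← mul_add, hu o ho', ← EReal.coe_neg, EReal.real_coe_toENNReal,
      EReal.real_coe_toENNReal]
    congr 1
    have h1 := hpay o ho'
    have h2 : 0 ≤ η * (o.units i : ℝ) := by positivity
    rcases le_total 0 (η * o.units i - o.pay i) with h3 | h3
    · rw [ENNReal.ofReal_of_nonpos (p := -(η * o.units i - o.pay i)) (by linarith), zero_add,
        ← ENNReal.ofReal_add h3 h1]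
      congr 1; ring
    · rw [ENNReal.ofReal_of_nonpos h3, zero_add, ← ENNReal.ofReal_add (by linarith) h2]
      congr 1; ring
  have hUle : U ≤ ENNReal.ofReal (η * (m * X i)) := by
    rw [← h.expected_units i η hη, hU]
    refine ENNReal.tsum_le_tsum fun o => ?_
    by_cases ho : μ o = 0
    · simp [ho]
    have ho' : o ∈ μ.support := (PMF.mem_support_iff _ _).2 ho
    rw [hu o ho', EReal.real_coe_toENNReal]
    gcongr
    linarith [hpay o ho']
  have hUt : U ≠ ⊤ := (hUle.trans_lt ENNReal.ofReal_lt_top).ne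
  have hVt : V ≠ ⊤ := by
    intro hVt
    rw [hVt, top_add] at hsum
    exact ENNReal.add_ne_top.2 ⟨hUt, ENNReal.ofReal_ne_top⟩ hsum
  have hreal := congrArg ENNReal.toReal hsum
  rw [ENNReal.toReal_add hUt ENNReal.ofReal_ne_top, ENNReal.toReal_add hVt ENNReal.ofReal_ne_top,
    ENNReal.toReal_ofReal hP, ENNReal.toReal_ofReal (by positivity)] at hreal
  change (U : EReal) - (V : EReal) = _
  rw [← ENNReal.ofReal_toReal hUt, ← ENNReal.ofReal_toReal hVt,
    EReal.coe_ennreal_ofReal, EReal.coe_ennreal_ofReal, max_eq_left ENNReal.toReal_nonneg,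
    max_eq_left ENNReal.toReal_nonneg, ← EReal.coe_sub]
  congr 1; linarith

/-- A positive chance of being charged more than the true budget makes the expected utility
`-∞`. -/
theorem IsGoodLottery.expectedUtility_eq_bot {m : ℕ} {B X P : Fin n → ℝ} {μ : PMF (Outcome n)}
    (h : IsGoodLottery m B X P μ) {i : Fin n} (hP : 0 < P i) {η β : ℝ} (hβ : β < B i) :
    expectedUtility η β i μ = ⊥ := by
  obtain ⟨o, ho, hpay⟩ := h.exists_pay i hP
  have hu : utility η β i o = ⊥ := by rw [utility, if_pos (by rw [hpay]; exact hβ)]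
  have : ∑' o, μ o * (-(utility η β i o)).toENNReal = ⊤ := by
    refine ENNReal.tsum_eq_top_of_eq_top ⟨o, ?_⟩
    rw [hu, EReal.neg_bot, EReal.toENNReal_top]
    exact ENNReal.mul_top ((PMF.mem_support_iff _ _).1 ho)
  -- In `EReal`, `x - ⊤ = ⊥` even for `x = ⊤`, so the positive part needs no bound.
  rw [expectedUtility, expectation, this]
  simp [sub_eq_add_neg]

end lottery

end

end BudgetAuction

/-! ### The randomized auction for `m` units. -/

open BudgetAuction
theorem corollary1 (n m : ℕ) (hn : 2 ≤ n) (hm : 1 ≤ m) :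
    ∃ M : BudgetAuction.RandomizedAuction n,
      BudgetAuction.RunsScaledClinching m M ∧
      BudgetAuction.NoPositiveTransfers M ∧
      BudgetAuction.VoluntaryParticipation M ∧
      BudgetAuction.IncentiveCompatible M ∧
      BudgetAuction.ParetoOptimal m M := by
  classical

  have hm0 : (0 : ℝ) < m := by exact_mod_cast hm
  have key : ∀ v B : Fin n → ℝ, ∃ μ : PMF (Outcome n), IsProfile v B → ∃ X P : Fin n → ℝ,
      IsClinchingOutcome (fun i => (m : ℝ) * v i) B X P ∧
      IsGoodOutcome (fun i => (m : ℝ) * v i) B X P ∧ IsGoodLottery m B X P μ := by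
    intro v B
    by_cases hvB : IsProfile v B
    · have hv : ∀ j, 0 < (m : ℝ) * v j := fun j => mul_pos hm0 (hvB j).1
      have hB : ∀ j, 0 < B j := fun j => (hvB j).2
      obtain ⟨X, P, h1, h2⟩ := exists_outcome hn hv hB
      obtain ⟨μ, hμ⟩ := exists_lottery hm hB (h2.alloc_nonneg hn hv hB) h2.total h2.pay_nonneg
        h2.pay_le
      exact ⟨μ, fun _ => ⟨X, P, h1, h2, hμ⟩⟩
    · exact ⟨PMF.pure ⟨fun _ => 0, fun _ => 0⟩, fun h => absurd h hvB⟩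
  choose M hM using key
  have truth : ∀ (v B X P : Fin n → ℝ), IsProfile v B →
      IsGoodOutcome (fun i => (m : ℝ) * v i) B X P → IsGoodLottery m B X P (M v B) → ∀ i,
      expectedUtility (v i) (B i) i (M v B) = ((m * v i * X i - P i : ℝ) : EReal) ∧
      0 ≤ (m : ℝ) * v i * X i - P i := by
    intro v B X P hvB h2 h3 i
    have hv : ∀ j, 0 < (m : ℝ) * v j := fun j => mul_pos hm0 (hvB j).1
    have hB : ∀ j, 0 < B j := fun j => (hvB j).2
    refine ⟨?_, h2.utility_nonneg hn hv hB i⟩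
    rw [h3.expectedUtility_eq (h2.alloc_nonneg hn hv hB i) (h2.pay_nonneg i) (hvB i).1.le
      (hB i).le fun o ho => ?_]
    · congr 1; ring
    · rcases h3.pay_mem o ho i with h | h <;> rw [h]
      exact (hB i).le
  refine ⟨M, fun v B hvB => ?_, fun v B hvB o ho i => ?_, fun v B hvB i => ?_,
    fun v B hvB i w b hw hb => ?_, fun v B hvB o ho => ?_⟩
  · obtain ⟨X, P, h1, -, h3⟩ := hM v B hvB
    exact ⟨X, P, h1, h3.isLottery⟩
  · obtain ⟨X, P, -, -, h3⟩ := hM v B hvB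
    rcases h3.pay_mem o ho i with h | h <;> rw [h]
    exact (hvB i).2.le
  · obtain ⟨X, P, -, h2, h3⟩ := hM v B hvB
    obtain ⟨h4, h5⟩ := truth v B X P hvB h2 h3 i
    rw [h4]; exact_mod_cast h5
  · obtain ⟨X, P, -, h2, h3⟩ := hM v B hvB
    obtain ⟨h4, h5⟩ := truth v B X P hvB h2 h3 i
    have hv : ∀ j, 0 < (m : ℝ) * v j := fun j => mul_pos hm0 (hvB j).1
    have hB : ∀ j, 0 < B j := fun j => (hvB j).2
    have hvB' : IsProfile (Function.update v i w) (Function.update B i b) := fun j => by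
      by_cases hj : j = i
      · subst hj; simpa using ⟨hw, hb⟩
      · simpa [hj] using hvB j
    obtain ⟨X', P', -, h2', h3'⟩ := hM _ _ hvB'
    have hv' : ∀ j, 0 < (m : ℝ) * Function.update v i w j := fun j => mul_pos hm0 (hvB' j).1
    have hB' : ∀ j, 0 < Function.update B i b j := fun j => (hvB' j).2
    have hX' := h2'.alloc_nonneg hn hv' hB' i
    have hP' := h2'.pay_nonneg i
    rw [h4]
    have hpay : ∀ o ∈ (M (Function.update v i w) (Function.update B i b)).support,
        o.pay i = b ∨ o.pay i = 0 := fun o ho => by simpa using h3'.pay_mem o ho i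
    rcases le_or_gt b (B i) with hbB | hbB
    · rw [h3'.expectedUtility_eq hX' hP' (hvB i).1.le (hB' i).le fun o ho => ?_]
      · have hupd : (fun j => (m : ℝ) * Function.update v i w j) =
            Function.update (fun j => (m : ℝ) * v j) i (m * w) := by
          funext j
          by_cases hj : j = i
          · subst hj; simp
          · simp [hj]
        rw [hupd] at h2'
        have := h2.utility_le_truth h2' hn hv hB (mul_pos hm0 hw) hb hbB
        rw [EReal.coe_le_coe_iff]
        linarith
      · rcases hpay o ho with h | h <;> rw [h]
        · exact hbB
        · exact (hB i).le
    -- With an exaggerated budget, a zero price means no goods and utility `0`, while a positive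
    -- price means expected utility `⊥`.
    · rcases hP'.eq_or_lt with h0 | h0
      · rw [h3'.expectedUtility_eq hX' hP' (hvB i).1.le (hB' i).le fun o ho => by
          rw [h3'.pay_none o ho i h0.symm]; exact (hB i).le]
        rw [h2'.alloc_eq_zero hn hv' hB' h0.symm, ← h0, EReal.coe_le_coe_iff]
        simpa using h5
      · rw [h3'.expectedUtility_eq_bot h0 (by simpa using hbB)]
        exact bot_le
  · obtain ⟨X, P, -, h2, h3⟩ := hM v B hvB
    obtain ⟨k, hk, hu⟩ := h3.units_mem o ho
    refine ⟨by simp [hu, allTo], fun i j hi hij => ?_⟩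
    have hik : i = k := by
      by_contra hne
      simp [hu, allTo, hne] at hi
    subst hik
    -- The winner has a positive fraction, so `j`, with her larger valuation, has exhausted her
    -- budget and is charged all of it.
    have hPj := h2.exhausted i j hk (mul_lt_mul_of_pos_left hij hm0)
    rw [h3.pay_full o ho j hPj, sub_self]
    exact (hvB i).1
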